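/- Let $S^1=\mathbb R/\mathbb Z$, $Z=S^1\times\mathbb R$, $T^2=S^1\times S^1$, $TT^2=T^2\times\mathbb R^2$. Let $D>0$ and $D_\pm\in\mathbb R$, and let $H=H(t,x,y)$ be a $C^\infty$ function on $S^1\times S^1\times\mathbb R$ (a time-periodic Hamiltonian on $S^1$) with $\partial_{yy}H>0$, $H=\tfrac12y^2+D_+$ for $y>D$ and $H=\tfrac12y^2+D_-$ for $y<-D$. Let $\hat f:Z\to Z$ be a map (for instance a twist map) generated by $H$: it is the time-1 map, from time $0$ to time $1$, of the flow of $\dot x=\partial_yH$, $\dot y=-\partial_xH$. Let $\hat L(t,x,v)=\sup_y\,(yv-H(t,x,y))$ be the Lagrangian associated with $H$. Let $A,B>0$ and let $h_\pm:\mathbb R\to\mathbb R$ be $C^\infty$ functions with $h_\pm''>0$, $h_+(y)=\tfrac12y^2-D_+$ for $y<D+1$, $h_+(y)=\sqrt{A+By^2}$ for $y>D+2$, $h_-(y)=\tfrac12y^2-D_-$ for $y>-D-1$, $h_-(y)=\sqrt{A+By^2}$ for $y<-D-2$. Put $$L(t,x,y)=\begin{cases}h_-(y)&y<-D\\ \hat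 L(t,x,y)&-D\le y\le D\\ h_+(y)&y>D\end{cases}\qquad F(t,x,v_1,v_2)=\begin{cases}v_1L(t,x,v_2/v_1)&v_1>0\\ \sqrt{Av_1^2+Bv_2^2}&v_1\le0.\end{cases}$$ Then $F$ is a $C^\infty$ Finsler metric on $T^2$ (smooth off the zero section, positively homogeneous, with $\partial_{v_iv_j}\tfrac12F^2$ positive definite for $v\ne0$), and its geodesic flow, the Euler–Lagrange flow of $\tfrac12F^2$ on $ST^2=F^{-1}(1)$, is defined for all times. Every point of $V_0=\{(0,h,v)\in ST^2: h\in S^1,\ v_1>0\}$ returns to $V_0$ under the geodesic flow, so the first return map $R:V_0\to V_0$ is well defined, and $R$ is conjugated via a diffeomorphism to $\hat f$. More precisely: 1. $g:V_0\to Z$, $g(0,h,v_1,v_2)=(h,v_2/v_1)$, is a diffeomorphism, and $g\circ R=E\circ g$, where $E:Z\to Z$ is the time-1 map, in coordinates (position, velocity), of the Euler–Lagrange flow of $L$. 2. There is a diffeomorphism $\Phi:V_0\to Z$ with $\Phi\circ R=\hat f\circ\Phi$ and $\mathcal L_0\circ\Phi=g$, where $\mathcal L_0(x,y)=(x,\partial_yH(0,x,y))$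 is the Legendre transformation at time $0$, which passes from momentum to velocity. (So $\Phi=g$ if $\mathcal L_0=\mathrm{id}$.) -/

import Mathlib

open Set Filter Topology
open scoped ContDiff

noncomputable section

namespace FinslerTwist

/-! ### The circle, the cylinder, the torus and its tangent bundle -/

/-- The circle `ℝ / ℤ`. -/
abbrev S1 := AddCircle (1 : ℝ)

/-- The cylinder `S¹ × ℝ`. -/
abbrev Cyl := S1 × ℝ

/-- The 2-torus; its points are written `(t, x)`. -/
abbrev T2 := S1 × S1

/-- The tangent bundle of the 2-torus, trivialised as `T² × ℝ²`. -/
abbrev TT2 := T2 × (ℝ × ℝ)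

/-- The universal covering of the torus. -/
def projT (q : ℝ × ℝ) : T2 := ((q.1 : S1), (q.2 : S1))

/-- The universal covering of the tangent bundle of the torus. -/
def projTT (w : (ℝ × ℝ) × (ℝ × ℝ)) : TT2 := (projT w.1, w.2)

/-- The universal covering of the cylinder. -/
def projZ (q : ℝ × ℝ) : Cyl := ((q.1 : S1), q.2)

/-- Smoothness on an arbitrary subset `S` of a manifold `X`: near every point of `S` the map is the
restriction of a smooth map. The smooth structures on `X` and `Y` are those for which the coverings
`pX : E → X` and `pY : E' → Y` by vector spaces are local diffeomorphisms. -/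
def IsSmoothOn {E E' X Y : Type*} [NormedAddCommGroup E] [NormedSpace ℝ E]
    [NormedAddCommGroup E'] [NormedSpace ℝ E'] (pX : E → X) (pY : E' → Y)
    (f : X → Y) (S : Set X) : Prop :=
  ∀ e : E, pX e ∈ S → ∃ G : E → E', ContDiffAt ℝ ∞ G e ∧
    ∀ᶠ w in 𝓝 e, pX w ∈ S → f (pX w) = pY (G w)

/-- `f` restricts to a diffeomorphism of `S ⊆ X` onto `T ⊆ Y`. -/
def IsDiffeoOn {E E' X Y : Type*} [NormedAddCommGroup E] [NormedSpace ℝ E]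
    [NormedAddCommGroup E'] [NormedSpace ℝ E'] (pX : E → X) (pY : E' → Y)
    (f : X → Y) (S : Set X) (T : Set Y) : Prop :=
  BijOn f S T ∧ IsSmoothOn pX pY f S ∧
    ∃ k : Y → X, InvOn k f S T ∧ IsSmoothOn pY pX k T

/-! ### Euler–Lagrange equations, Finsler metrics, geodesic flow -/

/-- `c` is a solution of the Euler–Lagrange equation
`d/dt (∂_v Λ(t, c, ċ)) = ∂_x Λ(t, c, ċ)`, on the whole real line. -/
def IsEulerLagrange {E : Type*} [NormedAddCommGroup E] [NormedSpace ℝ E]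
    (Λ : ℝ → E → E → ℝ) (c : ℝ → E) : Prop :=
  ContDiff ℝ 2 c ∧
    ∀ t : ℝ, HasDerivAt (fun s : ℝ => fderiv ℝ (fun v : E => Λ s (c s) v) (deriv c s))
      (fderiv ℝ (fun x : E => Λ t x (deriv c t)) (c t)) t

/-- Finsler metrics on the torus. -/
structure IsFinsler (F : T2 → ℝ × ℝ → ℝ) : Prop where
  nonneg : ∀ x v, 0 ≤ F x v
  smooth : ContDiffOn ℝ ∞ (fun w : (ℝ × ℝ) × (ℝ × ℝ) => F (projT w.1) w.2) {w | w.2 ≠ 0}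
  homogeneous : ∀ x v, ∀ r : ℝ, 0 < r → F x (r • v) = r * F x v
  strongly_convex : ∀ x, ∀ v : ℝ × ℝ, v ≠ 0 → ∀ w : ℝ × ℝ, w ≠ 0 →
    0 < fderiv ℝ (fun u : ℝ × ℝ => fderiv ℝ (fun u' : ℝ × ℝ => (1 / 2) * F x u' ^ 2) u) v w w

/-- The unit tangent bundle `F⁻¹(1)`. -/
def unitTangent (F : T2 → ℝ × ℝ → ℝ) : Set TT2 := {u | F u.1 u.2 = 1}

/-- `γ` is a trajectory `t ↦ (c(t), ċ(t))` of the Euler–Lagrange flow of `F² / 2`. -/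
def IsGeodesicTrajectory (F : T2 → ℝ × ℝ → ℝ) (γ : ℝ → TT2) : Prop :=
  ∃ c : ℝ → ℝ × ℝ,
    IsEulerLagrange (fun _ x v => (1 / 2) * F (projT x) v ^ 2) c ∧
    ∀ t, γ t = projTT (c t, deriv c t)

/-- `φ` is the (complete) geodesic flow of `F` on the unit tangent bundle: it preserves the unit
tangent bundle, and `t ↦ φ t u` is the one and only geodesic trajectory starting at `u`. -/
def IsGeodesicFlow (F : T2 → ℝ × ℝ → ℝ) (φ : ℝ → TT2 → TT2) : Prop :=
  (∀ t, MapsTo (φ t) (unitTangent F) (unitTangent F)) ∧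
    ∀ u ∈ unitTangent F, ∀ γ : ℝ → TT2,
      (IsGeodesicTrajectory F γ ∧ γ 0 = u) ↔ ∀ t, γ t = φ t u

/-- `R` is (on `S`) the first return map of the flow `φ` to `S`; in particular every point of `S`
returns to `S`. -/
def IsFirstReturnMap (φ : ℝ → TT2 → TT2) (S : Set TT2) (R : TT2 → TT2) : Prop :=
  ∀ u ∈ S, ∃ τ : ℝ, 0 < τ ∧ φ τ u = R u ∧ R u ∈ S ∧ ∀ t ∈ Ioo 0 τ, φ t u ∉ S

/-- The section `V₀ = {(0, h, v) ∈ ST² | v₁ > 0}`. -/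
def V0 (F : T2 → ℝ × ℝ → ℝ) : Set TT2 :=
  {u | u ∈ unitTangent F ∧ u.1.1 = 0 ∧ 0 < u.2.1}

/-- The map `(0, h, v₁, v₂) ↦ (h, v₂ / v₁)`. -/
def slopeMap (u : TT2) : Cyl := (u.1.2, u.2.2 / u.2.1)

/-! ### The Hamiltonian, its Legendre transform, and time-one maps -/

/-- `H(t, x, y)` is a smooth Hamiltonian on `S¹`, 1-periodic in time, strictly convex in the
momentum `y`, and equal to `y² / 2 + D₊` for `y > D` and to `y² / 2 + D₋` for `y < -D`. -/
structure IsConvexHamiltonian (H : T2 → ℝ → ℝ) (D Dp Dm : ℝ) : Prop where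
  smooth : ContDiff ℝ ∞ (fun q : (ℝ × ℝ) × ℝ => H (projT q.1) q.2)
  convex : ∀ z y, 0 < deriv (deriv (H z)) y
  upper : ∀ z y, D < y → H z y = y ^ 2 / 2 + Dp
  lower : ∀ z y, y < -D → H z y = y ^ 2 / 2 + Dm

/-- Solutions of Hamilton's equations `ẋ = ∂_y H`, `ẏ = -∂_x H`, lifted to the plane. -/
def IsHamiltonSolution (H : T2 → ℝ → ℝ) (x y : ℝ → ℝ) : Prop :=
  ∀ t : ℝ, HasDerivAt x (deriv (H (projT (t, x t))) (y t)) t ∧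
    HasDerivAt y (-deriv (fun ξ : ℝ => H (projT (t, ξ)) (y t)) (x t)) t

/-- `f` is the time-one map (from time `0` to time `1`) of the Hamiltonian flow of `H`. -/
def IsHamiltonTimeOneMap (H : T2 → ℝ → ℝ) (f : Cyl → Cyl) : Prop :=
  ∀ z w : Cyl, f z = w ↔ ∃ x y : ℝ → ℝ, IsHamiltonSolution H x y ∧
    projZ (x 0, y 0) = z ∧ projZ (x 1, y 1) = w

/-- The Legendre transformation `(x, y) ↦ (x, ∂_y H(0, x, y))` at time `0`. -/
def legendreZero (H : T2 → ℝ → ℝ) (z : Cyl) : Cyl := (z.1, deriv (H (0, z.1)) z.2)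

/-- `E` is the time-one map of the Euler–Lagrange flow, in position-velocity coordinates, of the
time-periodic Lagrangian `L(t, x, y)` on the circle. -/
def IsLagrangeTimeOneMap (L : T2 → ℝ → ℝ) (E : Cyl → Cyl) : Prop :=
  ∀ z w : Cyl, E z = w ↔ ∃ θ : ℝ → ℝ,
    IsEulerLagrange (fun t x v => L (projT (t, x)) v) θ ∧
    projZ (θ 0, deriv θ 0) = z ∧ projZ (θ 1, deriv θ 1) = w

/-- The Lagrangian associated with `H`: the fibrewise Legendre transform. -/
def legendreDual (H : T2 → ℝ → ℝ) (z : T2) (v : ℝ) : ℝ := ⨆ y : ℝ, (y * v - H z y)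

/-- The Lagrangian `L`, obtained from the one of `H` by modification for large `|y|`. -/
def modifiedLagrangian (H : T2 → ℝ → ℝ) (D : ℝ) (hp hm : ℝ → ℝ) (z : T2) (y : ℝ) : ℝ :=
  if y < -D then hm y else if y ≤ D then legendreDual H z y else hp y

/-- The metric `F` built from a Lagrangian `L`: `F(t, x, v) = v₁ L(t, x, v₂ / v₁)` for `v₁ > 0` and
`F(t, x, v) = √(A v₁² + B v₂²)` for `v₁ ≤ 0`. -/
def finslerOf (A B : ℝ) (L : T2 → ℝ → ℝ) (z : T2) (v : ℝ × ℝ) : ℝ :=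
  if 0 < v.1 then v.1 * L z (v.2 / v.1) else Real.sqrt (A * v.1 ^ 2 + B * v.2 ^ 2)

end FinslerTwist

end

open Set Filter Topology
open scoped ContDiff

noncomputable section

namespace FinslerTwist

open scoped Manifold

/-! ### Integral curves of vector fields -/

section ODE

variable {E : Type*} [NormedAddCommGroup E] [NormedSpace ℝ E]

/-! The `F`-length of a graph `t ↦ (t, x(t))` is the action `∫ L(t, x, ẋ) dt`, so geodesics with `v₁
> 0` are, up to parametrisation, graphs of extremals of `L`. These in turn correspond to solutions
of Hamilton's equations for `H`. The lift of a geodesic starting on `t = 0` returns to the section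
when its first coordinate reaches `1`, and there the Hamiltonian solution has run for time one.

Everything rests on a dichotomy. For `|y| > D` nothing depends on the base point: momentum and
velocity are conserved, and geodesics, extremals and Hamiltonian trajectories are all straight
(`deriv_const_of_outer`, `momentum_const`). It is therefore harmless that `L` is not the Legendre
dual of `H` at large velocities. Otherwise the motion stays in `|y| ≤ D`, equivalently `|v₂| ≤ D
v₁`, where `L` is the dual.

In that cone the momentum of a unit vector is `(-H, y)` (`fderiv_energy_fibre_cone`). Unit momenta
are thus parametrised by `(t, x, y)`, and the geodesic flow becomes the flow of `L⁻¹ • (1, ∂_y H,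
-∂_x H)`, the suspended Hamiltonian field with time rescaled (`geodesicField`). The field is smooth,
lattice invariant and complete, which gives existence and uniqueness of geodesics. Since `L` is
bounded in the cone, the first coordinate grows at a rate bounded below and the time change can be
inverted (`exists_hamiltonSolution`, `exists_return`).

For the metric itself, `L` is smooth because its pieces agree on overlaps, and positive because it
lies above its tangent lines where it equals `√(A + B v²)`. The two formulas for `F` agree on an
open cone containing every nonzero `v` with `v₁ ≤ 0` (`finsler_outer`). Positivity of the Hessian of
`F² / 2` reduces to `L > 0` and `L'' > 0` (`energy_hessian_pos`). -/

lemma contMDiff_vectorField {X : E → E} (hX : ContDiff ℝ 1 X) :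
    ContMDiff 𝓘(ℝ, E) 𝓘(ℝ, E).tangent 1
      (fun x => (⟨x, X x⟩ : TangentBundle 𝓘(ℝ, E) E)) :=
  contMDiff_vectorSpace_iff_contDiff.2 hX

/-- Integral curves of a `C¹` vector field are determined by their starting point. -/
lemma integralCurve_unique [CompleteSpace E] {X : E → E} (hX : ContDiff ℝ 1 X) {γ γ' : ℝ → E}
    (hγ : ∀ t, HasDerivAt γ (X (γ t)) t) (hγ' : ∀ t, HasDerivAt γ' (X (γ' t)) t)
    (h : γ 0 = γ' 0) : γ = γ' := by
  refine isMIntegralCurve_Ioo_eq_of_contMDiff_boundaryless (I := 𝓘(ℝ, E)) (v := X) (t₀ := 0)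
    (contMDiff_vectorField hX) (fun t => ?_) (fun t => ?_) h
  · exact (hγ t).hasFDerivAt.hasMFDerivAt
  · exact (hγ' t).hasFDerivAt.hasMFDerivAt

/-- A `C¹` vector field all of whose integral curves exist for a uniform time is complete. -/
lemma exists_integralCurve_of_uniform_time [CompleteSpace E] {X : E → E}
    (hX : ContDiff ℝ 1 X) {ε : ℝ} (hε : 0 < ε)
    (h : ∀ x, ∃ γ : ℝ → E, γ 0 = x ∧ ∀ t ∈ Ioo (-ε) ε, HasDerivAt γ (X (γ t)) t) (x : E) :
    ∃ γ : ℝ → E, γ 0 = x ∧ ∀ t, HasDerivAt γ (X (γ t)) t := by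
  obtain ⟨γ, h0, hγ⟩ := exists_isMIntegralCurve_of_isMIntegralCurveOn (I := 𝓘(ℝ, E)) (v := X)
    (contMDiff_vectorField hX) hε (fun x => by
      obtain ⟨γ, h0, hγ⟩ := h x
      exact ⟨γ, h0, fun t ht => (hγ t ht).hasFDerivAt.hasMFDerivAt.hasMFDerivWithinAt⟩) x
  refine ⟨γ, h0, fun t => ?_⟩
  have h1 : HasFDerivAt γ (ContinuousLinearMap.smulRight (1 : ℝ →L[ℝ] ℝ) (X (γ t))) t :=
    hasMFDerivAt_iff_hasFDerivAt.1 (hγ t)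
  simpa using h1.hasDerivAt

end ODE

/-- A continuous curve that is locally constant at the times when it takes the value `a` and takes
this value once is constant. -/
lemma eq_const_of_locally_const {Y : Type*} [TopologicalSpace Y] [T1Space Y] {g : ℝ → Y}
    (hg : Continuous g) {a : Y} (h : ∀ t, g t = a → ∀ᶠ s in 𝓝 t, g s = a) {t₀ : ℝ}
    (h₀ : g t₀ = a) (t : ℝ) : g t = a := by
  have hcl : IsClopen {s | g s = a} :=
    ⟨isClosed_singleton.preimage hg, isOpen_iff_mem_nhds.2 h⟩
  have := hcl.eq_univ ⟨t₀, h₀⟩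
  exact (this ▸ mem_univ t : t ∈ {s | g s = a})

/-- A function with vanishing derivative near `t` is locally constant. -/
lemma eventually_eq_of_hasDerivAt_zero {E : Type*} [NormedAddCommGroup E] [NormedSpace ℝ E]
    {g : ℝ → E} {t : ℝ} (h : ∀ᶠ s in 𝓝 t, HasDerivAt g 0 s) : ∀ᶠ s in 𝓝 t, g s = g t := by
  obtain ⟨ε, hε, hb⟩ := Metric.eventually_nhds_iff_ball.1 h
  filter_upwards [Metric.ball_mem_nhds t hε] with s hs
  refine (convex_ball t ε).is_const_of_fderivWithin_eq_zero (𝕜 := ℝ) (f := g)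
    (fun x hx => (hb x hx).differentiableAt.differentiableWithinAt) (fun x hx => ?_) hs
    (Metric.mem_ball_self hε)
  rw [fderivWithin_of_isOpen Metric.isOpen_ball hx, (hb x hx).hasFDerivAt.fderiv]
  ext; simp

/-! ### Convex functions of one variable -/

/-- The one form in which convexity is used: it identifies the supremum in the Legendre transform,
makes `L` positive, and bounds `L` above in the cone. -/
lemma tangent_le_of_deriv2_pos {g : ℝ → ℝ} (hg : ContDiff ℝ 2 g)
    (hg2 : ∀ y, 0 < deriv (deriv g) y) (a x : ℝ) : g a + deriv g a * (x - a) ≤ g x := by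
  have hd : Differentiable ℝ g := hg.differentiable (by norm_num)
  have hd2 : Differentiable ℝ (deriv g) := by
    have : ContDiff ℝ 1 (deriv g) := by
      have h2 : ContDiff ℝ (1 + 1) g := by simpa [one_add_one_eq_two] using hg
      exact (contDiff_succ_iff_deriv.1 h2).2.2
    exact this.differentiable (by norm_num)
  have hc : ConvexOn ℝ univ g := convexOn_univ_of_deriv2_nonneg hd hd2 fun y => (hg2 y).le
  rcases lt_trichotomy a x with h | h | h
  · have := hc.deriv_le_slope (mem_univ a) (mem_univ x) h (hd a)
    rw [slope_def_field, le_div_iff₀ (by linarith)] at this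
    linarith
  · subst h; simp
  · have := hc.slope_le_deriv (mem_univ x) (mem_univ a) h (hd a)
    rw [slope_def_field, div_le_iff₀ (by linarith)] at this
    linarith

/-! ### The lifted Hamiltonian and its fibrewise Legendre transform -/

/-- The lift to the universal covering of a function on `T² × ℝ`. -/
def lift (H : T2 → ℝ → ℝ) (q : (ℝ × ℝ) × ℝ) : ℝ := H (projT q.1) q.2

/-- The derivative in the fibre direction. -/
def velocity (H : T2 → ℝ → ℝ) (q : (ℝ × ℝ) × ℝ) : ℝ := fderiv ℝ (lift H) q (0, 1)

/-- The inverse of the fibrewise Legendre transformation. -/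
def momentum (H : T2 → ℝ → ℝ) (q : (ℝ × ℝ) × ℝ) : ℝ :=
  Function.invFun (fun y => velocity H (q.1, y)) q.2

/-- The lift of the Lagrangian associated with `H`. -/
def lagrangian (H : T2 → ℝ → ℝ) (q : (ℝ × ℝ) × ℝ) : ℝ :=
  momentum H q * q.2 - lift H (q.1, momentum H q)

lemma projT_surjective : Function.Surjective projT := by
  rintro ⟨a, b⟩
  obtain ⟨a, rfl⟩ := QuotientAddGroup.mk_surjective a
  obtain ⟨b, rfl⟩ := QuotientAddGroup.mk_surjective b
  exact ⟨(a, b), rfl⟩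

section smooth

variable {H : T2 → ℝ → ℝ} (hs : ContDiff ℝ ∞ (lift H))
include hs

lemma differentiable_lift : Differentiable ℝ (lift H) := hs.differentiable (by simp)

lemma contDiff_velocity : ContDiff ℝ ∞ (velocity H) :=
  (hs.fderiv_right (m := ∞) (by simp)).clm_apply contDiff_const

lemma hasDerivAt_fibre (p : ℝ × ℝ) (y : ℝ) :
    HasDerivAt (H (projT p)) (velocity H (p, y)) y := by
  have h := (differentiable_lift hs (p, y)).hasFDerivAt.comp_hasDerivAt y
    ((hasDerivAt_const y p).prodMk (hasDerivAt_id y))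
  exact h

lemma deriv_fibre (p : ℝ × ℝ) (y : ℝ) : deriv (H (projT p)) y = velocity H (p, y) :=
  (hasDerivAt_fibre hs p y).deriv

lemma deriv_fibre_fun (p : ℝ × ℝ) : deriv (H (projT p)) = fun y => velocity H (p, y) :=
  funext (deriv_fibre hs p)

lemma deriv_base (t x y : ℝ) : deriv (fun ξ : ℝ => H (projT (t, ξ)) y) x =
    fderiv ℝ (lift H) ((t, x), y) ((0, 1), 0) := by
  have h := (differentiable_lift hs ((t, x), y)).hasFDerivAt.comp_hasDerivAt x
    (((hasDerivAt_const x t).prodMk (hasDerivAt_id x)).prodMk (hasDerivAt_const x y))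
  exact h.deriv

lemma contDiff_fibre (p : ℝ × ℝ) : ContDiff ℝ ∞ (H (projT p)) :=
  hs.comp (contDiff_const.prodMk contDiff_id)

end smooth

namespace IsConvexHamiltonian

variable {H : T2 → ℝ → ℝ} {D Dp Dm : ℝ} (hH : IsConvexHamiltonian H D Dp Dm)
include hH

lemma contDiff_lift : ContDiff ℝ ∞ (lift H) := hH.smooth

lemma hasDerivAt_velocity (p : ℝ × ℝ) (y : ℝ) :
    HasDerivAt (fun y => velocity H (p, y)) (deriv (deriv (H (projT p))) y) y := by
  rw [deriv_fibre_fun hH.contDiff_lift]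
  exact (((contDiff_velocity hH.contDiff_lift).comp
    (contDiff_const.prodMk contDiff_id)).differentiable (by simp) y).hasDerivAt

lemma strictMono_velocity (p : ℝ × ℝ) : StrictMono (fun y => velocity H (p, y)) :=
  strictMono_of_deriv_pos fun y => by
    rw [(hH.hasDerivAt_velocity p y).deriv]; exact hH.convex _ _

lemma velocity_of_lt (p : ℝ × ℝ) {y : ℝ} (hy : D < y) : velocity H (p, y) = y := by
  rw [← deriv_fibre hH.contDiff_lift]
  have : H (projT p) =ᶠ[𝓝 y] fun y => y ^ 2 / 2 + Dp := by
    filter_upwards [lt_mem_nhds hy] with z hz using hH.upper _ _ hz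
  rw [this.deriv_eq]
  simp

lemma velocity_of_lt_neg (p : ℝ × ℝ) {y : ℝ} (hy : y < -D) : velocity H (p, y) = y := by
  rw [← deriv_fibre hH.contDiff_lift]
  have : H (projT p) =ᶠ[𝓝 y] fun y => y ^ 2 / 2 + Dm := by
    filter_upwards [gt_mem_nhds hy] with z hz using hH.lower _ _ hz
  rw [this.deriv_eq]
  simp

/-- The fibrewise Legendre map is the identity for `|y| > D`, so the intermediate value theorem
applies. -/
lemma surjective_velocity (p : ℝ × ℝ) : Function.Surjective (fun y => velocity H (p, y)) := by
  intro v
  have hc : Continuous (fun y => velocity H (p, y)) :=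
    (contDiff_velocity hH.contDiff_lift).continuous.comp (by fun_prop)
  set M := |v| + |D| + 1 with hM
  have h1 : velocity H (p, M) = M := hH.velocity_of_lt p (by
    have := le_abs_self D; have := abs_nonneg v; linarith)
  have h2 : velocity H (p, -M) = -M := hH.velocity_of_lt_neg p (by
    have := le_abs_self D; have := abs_nonneg v; linarith)
  refine mem_range_of_exists_le_of_exists_ge hc ⟨-M, ?_⟩ ⟨M, ?_⟩
  · simp only [h2]; have := neg_abs_le v; have := abs_nonneg D; linarith
  · simp only [h1]; have := le_abs_self v; have := abs_nonneg D; linarith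

lemma velocity_momentum (p : ℝ × ℝ) (v : ℝ) : velocity H (p, momentum H (p, v)) = v :=
  Function.rightInverse_invFun (hH.surjective_velocity p) v

lemma momentum_velocity (p : ℝ × ℝ) (y : ℝ) : momentum H (p, velocity H (p, y)) = y :=
  Function.leftInverse_invFun (hH.strictMono_velocity p).injective y

lemma momentum_eq {p : ℝ × ℝ} {y v : ℝ} (h : velocity H (p, y) = v) : momentum H (p, v) = y := by
  rw [← h, hH.momentum_velocity]

lemma momentum_of_lt (p : ℝ × ℝ) {v : ℝ} (hv : D < v) : momentum H (p, v) = v :=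
  hH.momentum_eq (hH.velocity_of_lt p hv)

lemma momentum_of_lt_neg (p : ℝ × ℝ) {v : ℝ} (hv : v < -D) : momentum H (p, v) = v :=
  hH.momentum_eq (hH.velocity_of_lt_neg p hv)

/-- A velocity beyond `D` is its own momentum, so it cannot come from a momentum in `[-D, D]`. -/
lemma abs_velocity_le {p : ℝ × ℝ} {y : ℝ} (hy : |y| ≤ D) : |velocity H (p, y)| ≤ D := by
  rw [abs_le] at hy ⊢
  constructor
  · by_contra! h
    have := hH.momentum_of_lt_neg p h
    rw [hH.momentum_velocity] at this
    linarith
  · by_contra! h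
    have := hH.momentum_of_lt p h
    rw [hH.momentum_velocity] at this
    linarith

lemma abs_momentum_le {p : ℝ × ℝ} {v : ℝ} (hv : |v| ≤ D) : |momentum H (p, v)| ≤ D := by
  rw [abs_le] at hv ⊢
  constructor
  · by_contra! h
    have := hH.velocity_of_lt_neg p h
    rw [hH.velocity_momentum] at this
    linarith
  · by_contra! h
    have := hH.velocity_of_lt p h
    rw [hH.velocity_momentum] at this
    linarith

/-- Inverse function theorem for `(p, y) ↦ (p, ∂_y H)`, whose differential is invertible because
`∂_yy H > 0`. Fibrewise injectivity identifies the local inverse with `momentum`. -/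
lemma contDiff_momentum : ContDiff ℝ ∞ (momentum H) := by
  set Ψ : (ℝ × ℝ) × ℝ → (ℝ × ℝ) × ℝ := fun q => (q.1, velocity H q) with hΨ
  have hΨs : ContDiff ℝ ∞ Ψ := contDiff_fst.prodMk (contDiff_velocity hH.contDiff_lift)
  rw [contDiff_iff_contDiffAt]
  rintro ⟨p, v⟩
  set q : (ℝ × ℝ) × ℝ := (p, momentum H (p, v)) with hq
  have hΨq : Ψ q = (p, v) := by simp [hΨ, hq, hH.velocity_momentum]
  have hvel : DifferentiableAt ℝ (velocity H) q :=
    (contDiff_velocity hH.contDiff_lift).differentiable (by simp) q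
  have hΨd : HasFDerivAt Ψ ((ContinuousLinearMap.fst ℝ (ℝ × ℝ) ℝ).prod
      (fderiv ℝ (velocity H) q)) q := hasFDerivAt_fst.prodMk hvel.hasFDerivAt
  set T := (ContinuousLinearMap.fst ℝ (ℝ × ℝ) ℝ).prod (fderiv ℝ (velocity H) q) with hT
  have hvert : fderiv ℝ (velocity H) q (0, 1) = deriv (deriv (H (projT p))) q.2 := by
    have h := hvel.hasFDerivAt.comp_hasDerivAt q.2
      ((hasDerivAt_const q.2 p).prodMk (hasDerivAt_id q.2))
    exact h.unique (hH.hasDerivAt_velocity p q.2)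
  have hinj : Function.Injective (T : (ℝ × ℝ) × ℝ →ₗ[ℝ] (ℝ × ℝ) × ℝ) := by
    rw [injective_iff_map_eq_zero]
    rintro ⟨a, b⟩ h
    have h1 : a = 0 := congrArg Prod.fst h
    have h2 : fderiv ℝ (velocity H) q (a, b) = 0 := congrArg Prod.snd h
    have h3 : ((a, b) : (ℝ × ℝ) × ℝ) = b • (0, 1) := by simp [h1]
    rw [h3, map_smul, hvert, smul_eq_mul, mul_eq_zero] at h2
    rcases h2 with h2 | h2
    · simp [h1, h2]
    · exact absurd h2 (hH.convex _ _).ne'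
  set e : ((ℝ × ℝ) × ℝ) ≃L[ℝ] (ℝ × ℝ) × ℝ :=
    (LinearEquiv.ofInjectiveEndo (T : (ℝ × ℝ) × ℝ →ₗ[ℝ] (ℝ × ℝ) × ℝ) hinj).toContinuousLinearEquiv
    with he
  have hΨe : HasFDerivAt Ψ (e : ((ℝ × ℝ) × ℝ) →L[ℝ] (ℝ × ℝ) × ℝ) q := by
    have : (e : ((ℝ × ℝ) × ℝ) →L[ℝ] (ℝ × ℝ) × ℝ) = T := by ext1 <;> rfl
    rw [this]
    exact hΨd
  have hloc := hΨs.contDiffAt.to_localInverse (a := q) hΨe (by simp)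
  have hstrict := (hΨs.contDiffAt (x := q)).hasStrictFDerivAt' hΨe (by simp)
  have hright := hstrict.eventually_right_inverse
  rw [hΨq] at hloc hright
  refine (contDiff_snd.contDiffAt.comp (p, v) hloc).congr_of_eventuallyEq ?_
  filter_upwards [hright] with w hw
  obtain ⟨h1, h2⟩ := Prod.ext_iff.1 hw
  refine hH.momentum_eq ?_
  rw [← h1]
  exact h2

lemma hasDerivAt_momentum (p : ℝ × ℝ) (v : ℝ) :
    HasDerivAt (fun v => momentum H (p, v))
      (deriv (deriv (H (projT p))) (momentum H (p, v)))⁻¹ v :=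
  HasDerivAt.of_local_left_inverse
    ((hH.contDiff_momentum.continuous.comp (by fun_prop : Continuous fun v => (p, v))).continuousAt)
    (hH.hasDerivAt_velocity p _) (hH.convex _ _).ne'
    (Eventually.of_forall fun v => hH.velocity_momentum p v)

lemma contDiff_lagrangian : ContDiff ℝ ∞ (lagrangian H) :=
  (hH.contDiff_momentum.mul contDiff_snd).sub
    (hH.contDiff_lift.comp (contDiff_fst.prodMk hH.contDiff_momentum))

/-- The envelope formula for the derivative of the Legendre transform. -/
lemma fderiv_lagrangian (q w : (ℝ × ℝ) × ℝ) : fderiv ℝ (lagrangian H) q w =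
    momentum H q * w.2 - fderiv ℝ (lift H) (q.1, momentum H q) (w.1, 0) := by
  have hm : HasFDerivAt (momentum H) (fderiv ℝ (momentum H) q) q :=
    (hH.contDiff_momentum.differentiable (by simp) q).hasFDerivAt
  have hl := (differentiable_lift hH.contDiff_lift (q.1, momentum H q)).hasFDerivAt.comp q
    (hasFDerivAt_fst.prodMk hm)
  have h : HasFDerivAt (lagrangian H) _ q := (hm.mul hasFDerivAt_snd).sub hl
  rw [h.fderiv]
  -- The vertical part of `dH` is the velocity `q.2`, so the terms containing the derivative of the
  -- momentum cancel.
  have h1 : fderiv ℝ (lift H) (q.1, momentum H q) (w.1, fderiv ℝ (momentum H) q w) =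
      fderiv ℝ (lift H) (q.1, momentum H q) (w.1, 0) + fderiv ℝ (momentum H) q w * q.2 := by
    have h2 : ((w.1, fderiv ℝ (momentum H) q w) : (ℝ × ℝ) × ℝ) =
        (w.1, 0) + fderiv ℝ (momentum H) q w • (0, 1) := by simp
    rw [h2, map_add, map_smul, smul_eq_mul]
    congr 2
    exact hH.velocity_momentum q.1 q.2
  simp [h1]
  ring

lemma hasDerivAt_lagrangian_fibre (p : ℝ × ℝ) (v : ℝ) :
    HasDerivAt (fun v => lagrangian H (p, v)) (momentum H (p, v)) v := by
  have h := (hH.contDiff_lagrangian.differentiable (by simp) (p, v)).hasFDerivAt.comp_hasDerivAt v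
    ((hasDerivAt_const v p).prodMk (hasDerivAt_id v))
  refine h.congr_deriv ?_
  rw [hH.fderiv_lagrangian]
  simp [show (((0 : ℝ × ℝ), (0 : ℝ)) : (ℝ × ℝ) × ℝ) = 0 from rfl]

/-- The tangent line of `H` of slope `v` touches at `momentum H (p, v)`, so the supremum is attained
there. -/
lemma legendreDual_eq (p : ℝ × ℝ) (v : ℝ) : legendreDual H (projT p) v = lagrangian H (p, v) := by
  have hle : ∀ y, y * v - H (projT p) y ≤ lagrangian H (p, v) := by
    intro y
    have := tangent_le_of_deriv2_pos
      ((contDiff_fibre hH.contDiff_lift p).of_le (by norm_cast))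
      (hH.convex (projT p)) (momentum H (p, v)) y
    rw [deriv_fibre hH.contDiff_lift, hH.velocity_momentum] at this
    simp only [lagrangian, lift]
    linarith
  exact le_antisymm (ciSup_le hle) (le_ciSup_of_le ⟨_, forall_mem_range.2 hle⟩ (momentum H (p, v))
    (by simp [lagrangian, lift]))

lemma lagrangian_of_lt (p : ℝ × ℝ) {v : ℝ} (hv : D < v) : lagrangian H (p, v) = v ^ 2 / 2 - Dp := by
  rw [lagrangian, hH.momentum_of_lt p hv, lift, hH.upper _ _ hv]; ring

lemma lagrangian_of_lt_neg (p : ℝ × ℝ) {v : ℝ} (hv : v < -D) :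
    lagrangian H (p, v) = v ^ 2 / 2 - Dm := by
  rw [lagrangian, hH.momentum_of_lt_neg p hv, lift, hH.lower _ _ hv]; ring

end IsConvexHamiltonian

/-! ### The modified Lagrangian -/

/-- The data from which the Finsler metric is built. -/
structure IsAdmissible (H : T2 → ℝ → ℝ) (D Dp Dm A B : ℝ) (hp hm : ℝ → ℝ) : Prop where
  D_pos : 0 < D
  ham : IsConvexHamiltonian H D Dp Dm
  A_pos : 0 < A
  B_pos : 0 < B
  hp_smooth : ContDiff ℝ ∞ hp
  hm_smooth : ContDiff ℝ ∞ hm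
  hp_convex : ∀ y, 0 < deriv (deriv hp) y
  hm_convex : ∀ y, 0 < deriv (deriv hm) y
  hp_inner : ∀ y, y < D + 1 → hp y = y ^ 2 / 2 - Dp
  hp_outer : ∀ y, D + 2 < y → hp y = Real.sqrt (A + B * y ^ 2)
  hm_inner : ∀ y, -D - 1 < y → hm y = y ^ 2 / 2 - Dm
  hm_outer : ∀ y, y < -D - 2 → hm y = Real.sqrt (A + B * y ^ 2)

lemma hasDerivAt_sqrt_quadratic {A B : ℝ} (hA : 0 < A) (hB : 0 < B) (w : ℝ) :
    HasDerivAt (fun y => Real.sqrt (A + B * y ^ 2)) (B * w / Real.sqrt (A + B * w ^ 2)) w := by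
  have hpos : 0 < A + B * w ^ 2 := by positivity
  have h : HasDerivAt (fun y : ℝ => A + B * y ^ 2) (B * (2 * w)) w := by
    simpa using ((hasDerivAt_pow 2 w).const_mul B).const_add A
  refine (h.sqrt hpos.ne').congr_deriv ?_
  field_simp

/-- A strictly convex function that equals `√(A + B y²)` near `w` is positive at all points on the
same side of the origin as `w`. -/
lemma pos_of_eventuallyEq_sqrt {A B : ℝ} (hA : 0 < A) (hB : 0 < B) {g : ℝ → ℝ}
    (hg : ContDiff ℝ 2 g) (hg2 : ∀ y, 0 < deriv (deriv g) y) {v w : ℝ} (hvw : 0 ≤ w * v)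
    (h : g =ᶠ[𝓝 w] fun y => Real.sqrt (A + B * y ^ 2)) : 0 < g v := by
  have ht := tangent_le_of_deriv2_pos hg hg2 w v
  rw [h.deriv_eq, (hasDerivAt_sqrt_quadratic hA hB w).deriv, h.eq_of_nhds] at ht
  have hpos : 0 < A + B * w ^ 2 := by positivity
  have hs : 0 < Real.sqrt (A + B * w ^ 2) := Real.sqrt_pos.2 hpos
  have hsq : Real.sqrt (A + B * w ^ 2) ^ 2 = A + B * w ^ 2 := Real.sq_sqrt hpos.le
  refine lt_of_lt_of_le ?_ ht
  set S := Real.sqrt (A + B * w ^ 2)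
  -- Value at `v` of the tangent line of the square root at `w`; its numerator is positive because
  -- `w * v ≥ 0`.
  have : S + B * w / S * (v - w) = (A + B * (w * v)) / S := by
    field_simp
    rw [hsq]; ring
  rw [this]
  positivity

namespace IsAdmissible

variable {H : T2 → ℝ → ℝ} {D Dp Dm A B : ℝ} {hp hm : ℝ → ℝ}
  (ha : IsAdmissible H D Dp Dm A B hp hm)
include ha

lemma modified_of_lt (z : T2) {v : ℝ} (hv : D < v) : modifiedLagrangian H D hp hm z v = hp v := by
  have := ha.D_pos
  rw [modifiedLagrangian, if_neg (by linarith), if_neg (by linarith)]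

omit ha in
lemma _root_.FinslerTwist.modifiedLagrangian_of_lt_neg (z : T2) {v : ℝ} (hv : v < -D) :
    modifiedLagrangian H D hp hm z v = hm v := by
  rw [modifiedLagrangian, if_pos hv]

/-- The dual of `y² / 2 + D±` is `v² / 2 - D±`, the inner form of `h±`. Hence `L` is the Legendre
dual on an open neighbourhood of `|v| ≤ D`, and derivatives may be compared at the boundary too. -/
lemma modified_of_abs_lt (p : ℝ × ℝ) {v : ℝ} (hv : |v| < D + 1) :
    modifiedLagrangian H D hp hm (projT p) v = lagrangian H (p, v) := by
  rw [abs_lt] at hv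
  rcases lt_or_ge v (-D) with h | h
  · rw [modifiedLagrangian_of_lt_neg _ h, ha.hm_inner _ (by linarith),
      ha.ham.lagrangian_of_lt_neg p h]
  rcases lt_or_ge D v with h' | h'
  · rw [ha.modified_of_lt _ h', ha.hp_inner _ (by linarith), ha.ham.lagrangian_of_lt p h']
  · rw [modifiedLagrangian, if_neg (by linarith), if_pos h', ha.ham.legendreDual_eq]

lemma contDiff_modified : ContDiff ℝ ∞ (lift (modifiedLagrangian H D hp hm)) := by
  rw [contDiff_iff_contDiffAt]
  rintro ⟨p, v⟩
  rcases lt_or_ge |v| (D + 1) with h | h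
  · refine ha.ham.contDiff_lagrangian.contDiffAt.congr_of_eventuallyEq ?_
    have : ∀ᶠ q : (ℝ × ℝ) × ℝ in 𝓝 (p, v), |q.2| < D + 1 :=
      (continuous_snd.abs.tendsto (p, v)).eventually (gt_mem_nhds h)
    filter_upwards [this] with q hq using ha.modified_of_abs_lt q.1 hq
  rcases le_abs.1 h with h | h
  · refine (ha.hp_smooth.comp contDiff_snd).contDiffAt.congr_of_eventuallyEq ?_
    have : ∀ᶠ q : (ℝ × ℝ) × ℝ in 𝓝 (p, v), D < q.2 :=
      (continuous_snd.tendsto (p, v)).eventually (lt_mem_nhds (by simp only; linarith))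
    filter_upwards [this] with q hq using ha.modified_of_lt _ hq
  · refine (ha.hm_smooth.comp contDiff_snd).contDiffAt.congr_of_eventuallyEq ?_
    have : ∀ᶠ q : (ℝ × ℝ) × ℝ in 𝓝 (p, v), q.2 < -D :=
      (continuous_snd.tendsto (p, v)).eventually (gt_mem_nhds (by simp only; linarith))
    filter_upwards [this] with q hq using modifiedLagrangian_of_lt_neg _ hq

lemma contDiff_modified_fibre (z : T2) : ContDiff ℝ ∞ (modifiedLagrangian H D hp hm z) := by
  obtain ⟨p, rfl⟩ := projT_surjective z
  exact contDiff_fibre ha.contDiff_modified p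

lemma modified_eventuallyEq_hp (z : T2) {v : ℝ} (hv : D < v) :
    modifiedLagrangian H D hp hm z =ᶠ[𝓝 v] hp := by
  filter_upwards [lt_mem_nhds hv] with w hw using ha.modified_of_lt _ hw

omit ha in
lemma _root_.FinslerTwist.modifiedLagrangian_eventuallyEq_hm (z : T2) {v : ℝ} (hv : v < -D) :
    modifiedLagrangian H D hp hm z =ᶠ[𝓝 v] hm := by
  filter_upwards [gt_mem_nhds hv] with w hw using modifiedLagrangian_of_lt_neg _ hw

lemma modified_eventuallyEq_lagrangian (p : ℝ × ℝ) {v : ℝ} (hv : |v| < D + 1) :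
    modifiedLagrangian H D hp hm (projT p) =ᶠ[𝓝 v] fun v => lagrangian H (p, v) := by
  filter_upwards [(continuous_abs.tendsto v).eventually (gt_mem_nhds hv)] with w hw
    using ha.modified_of_abs_lt p hw

lemma deriv_modified_of_abs_lt (p : ℝ × ℝ) {v : ℝ} (hv : |v| < D + 1) :
    deriv (modifiedLagrangian H D hp hm (projT p)) v = momentum H (p, v) := by
  rw [(ha.modified_eventuallyEq_lagrangian p hv).deriv_eq,
    (ha.ham.hasDerivAt_lagrangian_fibre p v).deriv]

lemma deriv2_modified_pos (z : T2) (v : ℝ) :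
    0 < deriv (deriv (modifiedLagrangian H D hp hm z)) v := by
  rcases lt_or_ge |v| (D + 1) with h | h
  · obtain ⟨p, rfl⟩ := projT_surjective z
    have : deriv (modifiedLagrangian H D hp hm (projT p)) =ᶠ[𝓝 v] fun v => momentum H (p, v) := by
      filter_upwards [(continuous_abs.tendsto v).eventually (gt_mem_nhds h)] with w hw
        using ha.deriv_modified_of_abs_lt p hw
    rw [this.deriv_eq, (ha.ham.hasDerivAt_momentum p v).deriv]
    exact inv_pos.2 (ha.ham.convex _ _)
  rcases le_abs.1 h with h | h
  · rw [(ha.modified_eventuallyEq_hp z (by linarith)).deriv.deriv_eq]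
    exact ha.hp_convex v
  · rw [(modifiedLagrangian_eventuallyEq_hm z (by linarith)).deriv.deriv_eq]
    exact ha.hm_convex v

lemma hp_eventuallyEq {v : ℝ} (hv : D + 2 < v) :
    hp =ᶠ[𝓝 v] fun y => Real.sqrt (A + B * y ^ 2) := by
  filter_upwards [lt_mem_nhds hv] with w hw using ha.hp_outer _ hw

lemma hm_eventuallyEq {v : ℝ} (hv : v < -D - 2) :
    hm =ᶠ[𝓝 v] fun y => Real.sqrt (A + B * y ^ 2) := by
  filter_upwards [gt_mem_nhds hv] with w hw using ha.hm_outer _ hw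

lemma modified_pos (z : T2) (v : ℝ) : 0 < modifiedLagrangian H D hp hm z v := by
  have hD := ha.D_pos
  have hc : ContDiff ℝ 2 (modifiedLagrangian H D hp hm z) :=
    (ha.contDiff_modified_fibre z).of_le (by norm_cast)
  -- Tangent lines at `±(D + 3)`, inside the region where `L` is the square root.
  rcases le_total 0 v with h | h
  · exact pos_of_eventuallyEq_sqrt ha.A_pos ha.B_pos hc (ha.deriv2_modified_pos z)
      (w := D + 3) (by positivity)
      ((ha.modified_eventuallyEq_hp z (by linarith)).trans (ha.hp_eventuallyEq (by linarith)))
  · exact pos_of_eventuallyEq_sqrt ha.A_pos ha.B_pos hc (ha.deriv2_modified_pos z)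
      (w := -D - 3) (by nlinarith)
      ((modifiedLagrangian_eventuallyEq_hm z (by linarith)).trans
        (ha.hm_eventuallyEq (by linarith)))

/-- The data force this sign: `h₊(0) = -D₊`, and `h₊(0)` lies above a tangent line of the square
root that is positive at `0`. -/
lemma Dp_neg : Dp < 0 := by
  have hD := ha.D_pos
  have := pos_of_eventuallyEq_sqrt ha.A_pos ha.B_pos (ha.hp_smooth.of_le (by norm_cast))
    ha.hp_convex (v := 0) (w := D + 3) (by simp) (ha.hp_eventuallyEq (by linarith))
  rw [ha.hp_inner 0 (by linarith)] at this
  linarith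

lemma Dm_neg : Dm < 0 := by
  have hD := ha.D_pos
  have := pos_of_eventuallyEq_sqrt ha.A_pos ha.B_pos (ha.hm_smooth.of_le (by norm_cast))
    ha.hm_convex (v := 0) (w := -D - 3) (by simp) (ha.hm_eventuallyEq (by linarith))
  rw [ha.hm_inner 0 (by linarith)] at this
  linarith

lemma lagrangian_pos (q : (ℝ × ℝ) × ℝ) : 0 < lagrangian H q := by
  rcases lt_or_ge |q.2| (D + 1) with h | h
  · rw [← Prod.mk.eta (p := q), ← ha.modified_of_abs_lt q.1 h]
    exact ha.modified_pos _ _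
  rcases le_abs.1 h with h | h
  · rw [← Prod.mk.eta (p := q), ha.ham.lagrangian_of_lt q.1 (by linarith)]
    have := ha.Dp_neg
    have := sq_nonneg q.2
    linarith
  · rw [← Prod.mk.eta (p := q), ha.ham.lagrangian_of_lt_neg q.1 (by linarith)]
    have := ha.Dm_neg
    have := sq_nonneg q.2
    linarith

end IsAdmissible

/-! ### The Finsler metric -/

/-- The second derivative of `Q` at `v` in the direction `w`, computed along a line. -/
lemma fderiv_fderiv_apply_of_line {Q : ℝ × ℝ → ℝ} {v w : ℝ × ℝ} (hQ : ContDiffAt ℝ 2 Q v)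
    {g : ℝ → ℝ} {g₂ : ℝ}
    (h₁ : ∀ᶠ s in 𝓝 (0 : ℝ), HasDerivAt (fun s : ℝ => Q (v + s • w)) (g s) s)
    (h₂ : HasDerivAt g g₂ 0) : fderiv ℝ (fun u => fderiv ℝ Q u) v w w = g₂ := by
  have hline : ∀ s : ℝ, HasDerivAt (fun s : ℝ => v + s • w) w s := fun s => by
    simpa using ((hasDerivAt_id s).smul_const w).const_add v
  have hl0 : (fun s : ℝ => v + s • w) 0 = v := by simp
  have htend : Tendsto (fun s : ℝ => v + s • w) (𝓝 0) (𝓝 v) := by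
    simpa using (hline 0).continuousAt.tendsto
  have hQd : ∀ᶠ u in 𝓝 v, DifferentiableAt ℝ Q u := by
    filter_upwards [hQ.eventually (by simp)] with u hu using hu.differentiableAt (by simp)
  have hQ2 : DifferentiableAt ℝ (fderiv ℝ Q) v :=
    (hQ.fderiv_right (m := 1) (by norm_num [one_add_one_eq_two])).differentiableAt (by simp)
  have h3 : HasDerivAt (fun s : ℝ => fderiv ℝ Q (v + s • w) w)
      (fderiv ℝ (fderiv ℝ Q) v w w) 0 := by
    have h := hQ2.hasFDerivAt.comp_hasDerivAt_of_eq (0 : ℝ) (hline 0) hl0.symm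
    simpa using h.clm_apply (hasDerivAt_const (0 : ℝ) w)
  refine h3.unique (h₂.congr_of_eventuallyEq ?_)
  filter_upwards [h₁, htend.eventually hQd] with s hs hs'
  exact (hs'.hasFDerivAt.comp_hasDerivAt s (hline s)).unique hs

namespace IsAdmissible

variable {H : T2 → ℝ → ℝ} {D Dp Dm A B : ℝ} {hp hm : ℝ → ℝ}
  (ha : IsAdmissible H D Dp Dm A B hp hm)

omit ha in
lemma _root_.FinslerTwist.finslerOf_of_pos {L : T2 → ℝ → ℝ} (z : T2) {v : ℝ × ℝ} (hv : 0 < v.1) :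
    finslerOf A B L z v = v.1 * L z (v.2 / v.1) := by rw [finslerOf, if_pos hv]

omit ha in
lemma _root_.FinslerTwist.finslerOf_of_nonpos {L : T2 → ℝ → ℝ} (z : T2) {v : ℝ × ℝ}
    (hv : v.1 ≤ 0) : finslerOf A B L z v = Real.sqrt (A * v.1 ^ 2 + B * v.2 ^ 2) := by
  rw [finslerOf, if_neg (by linarith)]

include ha

lemma quadratic_pos {v : ℝ × ℝ} (hv : v ≠ 0) : 0 < A * v.1 ^ 2 + B * v.2 ^ 2 := by
  have hA := ha.A_pos
  have hB := ha.B_pos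
  rcases eq_or_ne v.1 0 with h | h
  · have : v.2 ≠ 0 := fun h' => hv (Prod.ext h h')
    positivity
  · positivity

/-- This open cone meets `v₁ > 0` and contains every nonzero vector with `v₁ ≤ 0`, so it is where
the two formulas for `F` are glued. -/
lemma finsler_outer (z : T2) {v : ℝ × ℝ} (hv : (D + 2) * v.1 < |v.2|) :
    finslerOf A B (modifiedLagrangian H D hp hm) z v = Real.sqrt (A * v.1 ^ 2 + B * v.2 ^ 2) := by
  have hD := ha.D_pos
  rcases le_or_gt v.1 0 with h | h
  · exact finslerOf_of_nonpos z h
  have key : modifiedLagrangian H D hp hm z (v.2 / v.1) =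
      Real.sqrt (A + B * (v.2 / v.1) ^ 2) := by
    rcases lt_abs.1 hv with h' | h'
    · have : D + 2 < v.2 / v.1 := by rwa [lt_div_iff₀ h]
      rw [ha.modified_of_lt z (by linarith), ha.hp_outer _ this]
    · have : v.2 / v.1 < -D - 2 := by rw [div_lt_iff₀ h]; linarith
      rw [modifiedLagrangian_of_lt_neg z (by linarith), ha.hm_outer _ this]
  rw [finslerOf_of_pos z h, key]
  nth_rewrite 1 [← Real.sqrt_sq h.le]
  rw [← Real.sqrt_mul (sq_nonneg _)]
  congr 1
  field_simp

/-- Off the cone `|v₂| ≤ D v₁` the metric does not depend on the base point. -/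
lemma finsler_base_indep (z z' : T2) {v : ℝ × ℝ} (hv : D * v.1 < |v.2|) :
    finslerOf A B (modifiedLagrangian H D hp hm) z v =
      finslerOf A B (modifiedLagrangian H D hp hm) z' v := by
  rcases le_or_gt v.1 0 with h | h
  · rw [finslerOf_of_nonpos z h, finslerOf_of_nonpos z' h]
  rw [finslerOf_of_pos z h, finslerOf_of_pos z' h]
  rcases lt_abs.1 hv with h' | h'
  · have : D < v.2 / v.1 := by rwa [lt_div_iff₀ h]
    rw [ha.modified_of_lt z this, ha.modified_of_lt z' this]
  · have : v.2 / v.1 < -D := by rw [div_lt_iff₀ h]; linarith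
    rw [modifiedLagrangian_of_lt_neg z this, modifiedLagrangian_of_lt_neg z' this]

lemma outer_of_nonpos {v : ℝ × ℝ} (hv : v ≠ 0) (h : v.1 ≤ 0) : (D + 2) * v.1 < |v.2| := by
  have hD := ha.D_pos
  rcases eq_or_lt_of_le h with h | h
  · have : v.2 ≠ 0 := fun h' => hv (Prod.ext h h')
    rw [h, mul_zero]
    positivity
  · have := abs_nonneg v.2
    nlinarith

lemma finsler_pos (z : T2) {v : ℝ × ℝ} (hv : v ≠ 0) :
    0 < finslerOf A B (modifiedLagrangian H D hp hm) z v := by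
  rcases le_or_gt v.1 0 with h | h
  · rw [finslerOf_of_nonpos z h]
    exact Real.sqrt_pos.2 (ha.quadratic_pos hv)
  · rw [finslerOf_of_pos z h]
    exact mul_pos h (ha.modified_pos _ _)

lemma finsler_contDiffAt {w : (ℝ × ℝ) × (ℝ × ℝ)} (hw : w.2 ≠ 0) :
    ContDiffAt ℝ ∞ (fun w : (ℝ × ℝ) × (ℝ × ℝ) =>
      finslerOf A B (modifiedLagrangian H D hp hm) (projT w.1) w.2) w := by
  rcases le_or_gt w.2.1 0 with h | h
  · have hq : ContDiffAt ℝ ∞ (fun w : (ℝ × ℝ) × (ℝ × ℝ) =>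
        Real.sqrt (A * w.2.1 ^ 2 + B * w.2.2 ^ 2)) w :=
      ContDiffAt.sqrt (by fun_prop) (ha.quadratic_pos hw).ne'
    refine hq.congr_of_eventuallyEq ?_
    have ho : IsOpen {w : (ℝ × ℝ) × (ℝ × ℝ) | (D + 2) * w.2.1 < |w.2.2|} :=
      isOpen_lt (by fun_prop) (by fun_prop)
    filter_upwards [ho.mem_nhds (ha.outer_of_nonpos hw h)] with u hu using ha.finsler_outer _ hu
  · have hdiv : ContDiffAt ℝ ∞ (fun w : (ℝ × ℝ) × (ℝ × ℝ) => w.2.2 / w.2.1) w :=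
      ContDiffAt.div (by fun_prop) (by fun_prop) h.ne'
    have hq : ContDiffAt ℝ ∞ (fun w : (ℝ × ℝ) × (ℝ × ℝ) =>
        w.2.1 * lift (modifiedLagrangian H D hp hm) (w.1, w.2.2 / w.2.1)) w :=
      ContDiffAt.mul (by fun_prop)
        (ha.contDiff_modified.contDiffAt.comp w (contDiffAt_fst.prodMk hdiv))
    refine hq.congr_of_eventuallyEq ?_
    have ho : IsOpen {w : (ℝ × ℝ) × (ℝ × ℝ) | 0 < w.2.1} := isOpen_lt (by fun_prop) (by fun_prop)
    filter_upwards [ho.mem_nhds h] with u hu using finslerOf_of_pos _ hu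

lemma finsler_contDiffAt_fibre (z : T2) {v : ℝ × ℝ} (hv : v ≠ 0) :
    ContDiffAt ℝ ∞ (finslerOf A B (modifiedLagrangian H D hp hm) z) v := by
  obtain ⟨p, rfl⟩ := projT_surjective z
  exact ContDiffAt.comp (x := v)
    (g := fun w : (ℝ × ℝ) × (ℝ × ℝ) =>
      finslerOf A B (modifiedLagrangian H D hp hm) (projT w.1) w.2) (f := fun v => (p, v))
    (ha.finsler_contDiffAt (w := (p, v)) hv) (contDiffAt_const.prodMk contDiffAt_id)

/-- Along a line in direction `w` the second derivative of `F² / 2` is `F'² + F F''`. For `v₁ ≤ 0`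
it is that of a definite quadratic form. For `v₁ > 0` both summands are nonnegative, and they do not
vanish together. -/
lemma energy_hessian_pos (z : T2) {v w : ℝ × ℝ} (hv : v ≠ 0) (hw : w ≠ 0) :
    0 < fderiv ℝ (fun u : ℝ × ℝ => fderiv ℝ (fun u' : ℝ × ℝ =>
      (1 / 2) * finslerOf A B (modifiedLagrangian H D hp hm) z u' ^ 2) u) v w w := by
  set L := modifiedLagrangian H D hp hm with hL
  set Q : ℝ × ℝ → ℝ := fun u' => (1 / 2) * finslerOf A B L z u' ^ 2 with hQdef
  have hQ : ContDiffAt ℝ 2 Q v :=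
    (contDiffAt_const.mul ((ha.finsler_contDiffAt_fibre z hv).pow 2)).of_le (by norm_cast)
  have hlin₁ : ∀ s : ℝ, HasDerivAt (fun s : ℝ => v.1 + s * w.1) w.1 s := fun s => by
    simpa using ((hasDerivAt_id s).mul_const w.1).const_add v.1
  have hlin₂ : ∀ s : ℝ, HasDerivAt (fun s : ℝ => v.2 + s * w.2) w.2 s := fun s => by
    simpa using ((hasDerivAt_id s).mul_const w.2).const_add v.2
  have htend : Tendsto (fun s : ℝ => v + s • w) (𝓝 0) (𝓝 v) := by
    have : Continuous (fun s : ℝ => v + s • w) := by fun_prop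
    simpa using this.tendsto 0
  rcases le_or_gt v.1 0 with h | h
  · have hmem : ∀ᶠ s in 𝓝 (0 : ℝ), (D + 2) * (v + s • w).1 < |(v + s • w).2| :=
      htend.eventually ((isOpen_lt (by fun_prop) (by fun_prop) :
        IsOpen {u : ℝ × ℝ | (D + 2) * u.1 < |u.2|}).mem_nhds (ha.outer_of_nonpos hv h))
    have hval : ∀ᶠ s in 𝓝 (0 : ℝ), Q (v + s • w) =
        (1 / 2) * (A * (v.1 + s * w.1) ^ 2 + B * (v.2 + s * w.2) ^ 2) := by
      filter_upwards [hmem] with s hs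
      have hA := ha.A_pos
      have hB := ha.B_pos
      simp only [hQdef]
      rw [ha.finsler_outer z hs, Real.sq_sqrt (by positivity)]
      simp
    rw [fderiv_fderiv_apply_of_line hQ (w := w)
      (g := fun s => A * (v.1 + s * w.1) * w.1 + B * (v.2 + s * w.2) * w.2)
      (g₂ := A * w.1 ^ 2 + B * w.2 ^ 2)]
    · exact ha.quadratic_pos hw
    · filter_upwards [hval.eventually_nhds] with s hs
      refine HasDerivAt.congr_of_eventuallyEq ?_ hs
      refine ((((hlin₁ s).pow 2).const_mul A).add (((hlin₂ s).pow 2).const_mul B)).const_mul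
        (1 / 2) |>.congr_deriv ?_
      simp
      ring
    · refine ((((hlin₁ 0).const_mul A).mul_const w.1).add
        (((hlin₂ 0).const_mul B).mul_const w.2)).congr_deriv ?_
      ring
  -- The determinant of `v` and `w`, unchanged when `v` moves along the line; it vanishes exactly
  -- when `w` is parallel to `v`.
  · set κ := w.2 * v.1 - v.2 * w.1 with hκ
    have hL1 : ∀ m, HasDerivAt (L z) (deriv (L z) m) m := fun m =>
      ((ha.contDiff_modified_fibre z).differentiable (by simp) m).hasDerivAt
    have hL2 : ∀ m, HasDerivAt (deriv (L z)) (deriv (deriv (L z)) m) m := fun m => by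
      have : ContDiff ℝ (∞ + 1) (L z) := ha.contDiff_modified_fibre z
      exact ((contDiff_succ_iff_deriv.1 this).2.2.differentiable (by simp) m).hasDerivAt
    have hmem : ∀ᶠ s in 𝓝 (0 : ℝ), 0 < v.1 + s * w.1 := by
      have := (hlin₁ 0).continuousAt.tendsto
      simp only [zero_mul, add_zero] at this
      exact this.eventually (lt_mem_nhds h)
    have hval : ∀ᶠ s in 𝓝 (0 : ℝ), Q (v + s • w) = (1 / 2) *
        ((v.1 + s * w.1) * L z ((v.2 + s * w.2) / (v.1 + s * w.1))) ^ 2 := by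
      filter_upwards [hmem] with s hs
      simp only [hQdef]
      rw [finslerOf_of_pos z (by simpa using hs)]
      simp
    have hm : ∀ s, 0 < v.1 + s * w.1 → HasDerivAt
        (fun s => (v.2 + s * w.2) / (v.1 + s * w.1)) (κ / (v.1 + s * w.1) ^ 2) s := by
      intro s hs
      refine ((hlin₂ s).div (hlin₁ s) hs.ne').congr_deriv ?_
      rw [hκ]
      ring
    have hF : ∀ s, 0 < v.1 + s * w.1 → HasDerivAt
        (fun s => (v.1 + s * w.1) * L z ((v.2 + s * w.2) / (v.1 + s * w.1)))
        (w.1 * L z ((v.2 + s * w.2) / (v.1 + s * w.1)) +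
          κ * deriv (L z) ((v.2 + s * w.2) / (v.1 + s * w.1)) / (v.1 + s * w.1)) s := by
      intro s hs
      refine ((hlin₁ s).mul ((hL1 _).comp s (hm s hs))).congr_deriv ?_
      simp only [Function.comp_apply]
      field_simp
    have h0 : 0 < v.1 + 0 * w.1 := by simpa using h
    have hF' := ((hL1 _).comp 0 (hm 0 h0)).const_mul w.1 |>.add
      ((((hL2 _).comp 0 (hm 0 h0)).const_mul κ).div (hlin₁ 0) h0.ne')
    set m₀ := v.2 / v.1 with hm₀
    -- Here `g = F F'` and `g₂ = F'² + F F''`, with `F'' = κ² L'' / v₁³` after the terms in `κ w₁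
    -- L'` cancel.
    rw [fderiv_fderiv_apply_of_line hQ (w := w)
      (g := fun s => ((v.1 + s * w.1) * L z ((v.2 + s * w.2) / (v.1 + s * w.1))) *
        (w.1 * L z ((v.2 + s * w.2) / (v.1 + s * w.1)) +
          κ * deriv (L z) ((v.2 + s * w.2) / (v.1 + s * w.1)) / (v.1 + s * w.1)))
      (g₂ := (w.1 * L z m₀ + κ * deriv (L z) m₀ / v.1) ^ 2 +
        v.1 * L z m₀ * (κ ^ 2 * deriv (deriv (L z)) m₀ / v.1 ^ 3))]
    · have hLpos := ha.modified_pos z m₀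
      have hL2pos := ha.deriv2_modified_pos z m₀
      rw [← hL] at hLpos hL2pos
      -- If `κ = 0`, then `w₁ ≠ 0` and the square is `(w₁ L)² > 0`; otherwise the term with `L''` is
      -- positive.
      rcases eq_or_ne κ 0 with hk | hk
      · have hw1 : w.1 ≠ 0 := by
          intro h1
          have : w.2 * v.1 = 0 := by rw [hκ, h1] at hk; simpa using hk
          rcases mul_eq_zero.1 this with h2 | h2
          · exact hw (Prod.ext h1 h2)
          · exact h.ne' h2
        rw [hk]
        simp only [zero_mul, zero_div, add_zero, ne_eq, OfNat.ofNat_ne_zero, not_false_eq_true,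
          zero_pow, mul_zero]
        positivity
      · positivity
    · filter_upwards [hval.eventually_nhds, hmem] with s hs hs'
      refine HasDerivAt.congr_of_eventuallyEq ?_ hs
      refine (((hF s hs').pow 2).const_mul (1 / 2)).congr_deriv ?_
      simp
      ring
    · refine ((hF 0 h0).mul hF').congr_deriv ?_
      simp only [zero_mul, add_zero, Function.comp_apply, Pi.add_apply, Pi.div_apply, ← hm₀]
      field_simp
      ring

lemma isFinsler : IsFinsler (finslerOf A B (modifiedLagrangian H D hp hm)) where
  nonneg z v := by
    rcases eq_or_ne v 0 with rfl | hv
    · rw [finslerOf_of_nonpos z le_rfl]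
      exact Real.sqrt_nonneg _
    · exact (ha.finsler_pos z hv).le
  smooth := fun _ hw => (ha.finsler_contDiffAt hw).contDiffWithinAt
  homogeneous z v r hr := by
    rcases le_or_gt v.1 0 with h | h
    · rw [finslerOf_of_nonpos z h, finslerOf_of_nonpos z (by
        simpa using mul_nonpos_of_nonneg_of_nonpos hr.le h)]
      rw [← Real.sqrt_sq hr.le, ← Real.sqrt_mul (sq_nonneg _), Real.sqrt_sq hr.le]
      congr 1
      simp only [Prod.smul_fst, Prod.smul_snd, smul_eq_mul]
      ring
    · rw [finslerOf_of_pos z h, finslerOf_of_pos z (by simpa using mul_pos hr h)]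
      simp only [Prod.smul_fst, Prod.smul_snd, smul_eq_mul]
      rw [mul_div_mul_left _ _ hr.ne', mul_assoc]
  strongly_convex z v hv w hw := ha.energy_hessian_pos z hv hw

end IsAdmissible

/-! ### Hamilton's equations and the Euler–Lagrange equation of the modified Lagrangian -/

lemma fderiv_eq_deriv_smul {f : ℝ → ℝ} {x : ℝ} :
    fderiv ℝ f x = deriv f x • ContinuousLinearMap.id ℝ ℝ := by
  ext; simp

/-- The Euler–Lagrange equation in one space dimension, in terms of ordinary derivatives. -/
lemma isEulerLagrange_real_iff {Λ : ℝ → ℝ → ℝ → ℝ} {c : ℝ → ℝ} :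
    IsEulerLagrange Λ c ↔ ContDiff ℝ 2 c ∧
      ∀ t, HasDerivAt (fun s => deriv (Λ s (c s)) (deriv c s))
        (deriv (fun x => Λ t x (deriv c t)) (c t)) t := by
  refine and_congr_right fun _ => forall_congr' fun t => ⟨fun h => ?_, fun h => ?_⟩
  · simpa using h.clm_apply (hasDerivAt_const t (1 : ℝ))
  · simp only [fderiv_eq_deriv_smul]
    exact h.smul_const _

namespace IsConvexHamiltonian

variable {H : T2 → ℝ → ℝ} {D Dp Dm : ℝ} (hH : IsConvexHamiltonian H D Dp Dm)
include hH

lemma isHamiltonSolution_iff {x y : ℝ → ℝ} : IsHamiltonSolution H x y ↔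
    ∀ t, HasDerivAt x (velocity H ((t, x t), y t)) t ∧
      HasDerivAt y (-fderiv ℝ (lift H) ((t, x t), y t) ((0, 1), 0)) t := by
  refine forall_congr' fun t => ?_
  rw [deriv_fibre hH.contDiff_lift, deriv_base hH.contDiff_lift]

lemma lift_base_indep (p p' : ℝ × ℝ) {y : ℝ} (hy : D < |y|) : lift H (p, y) = lift H (p', y) := by
  rcases lt_abs.1 hy with h | h
  · simp only [lift, hH.upper _ _ h]
  · simp only [lift, hH.lower _ _ (show y < -D by linarith)]

lemma velocity_of_lt_abs (p : ℝ × ℝ) {y : ℝ} (hy : D < |y|) : velocity H (p, y) = y := by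
  rcases lt_abs.1 hy with h | h
  · exact hH.velocity_of_lt p h
  · exact hH.velocity_of_lt_neg p (by linarith)

lemma momentum_of_lt_abs (p : ℝ × ℝ) {v : ℝ} (hv : D < |v|) : momentum H (p, v) = v :=
  hH.momentum_eq (hH.velocity_of_lt_abs p hv)

lemma fderiv_lift_base_eq_zero (p w : ℝ × ℝ) {y : ℝ} (hy : D < |y|) :
    fderiv ℝ (lift H) (p, y) (w, 0) = 0 := by
  have hline : HasDerivAt (fun s : ℝ => ((p + s • w, y) : (ℝ × ℝ) × ℝ)) (w, 0) 0 := by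
    have : HasDerivAt (fun s : ℝ => p + s • w) w 0 := by
      simpa using ((hasDerivAt_id (0 : ℝ)).smul_const w).const_add p
    exact this.prodMk (hasDerivAt_const _ _)
  have h := (differentiable_lift hH.contDiff_lift (p, y)).hasFDerivAt.comp_hasDerivAt_of_eq
    (0 : ℝ) hline (by simp)
  refine h.unique ((hasDerivAt_const (0 : ℝ) (lift H (p, y))).congr_of_eventuallyEq ?_)
  exact Eventually.of_forall fun s => hH.lift_base_indep _ _ hy

/-- In the region `|y| > D` the momentum is conserved. -/
lemma momentum_const {x y : ℝ → ℝ} (h : IsHamiltonSolution H x y) {t₀ : ℝ} (h₀ : D < |y t₀|)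
    (t : ℝ) : y t = y t₀ := by
  have hs := hH.isHamiltonSolution_iff.1 h
  have hc : Continuous y := continuous_iff_continuousAt.2 fun t => (hs t).2.continuousAt
  refine eq_const_of_locally_const hc (fun t ht => ?_) rfl t
  have hev : ∀ᶠ s in 𝓝 t, D < |y s| :=
    (hc.abs.tendsto t).eventually (lt_mem_nhds (by rwa [ht]))
  rw [← ht]
  refine eventually_eq_of_hasDerivAt_zero ?_
  filter_upwards [hev] with s hs'
  refine (hs s).2.congr_deriv ?_
  rw [hH.fderiv_lift_base_eq_zero _ _ hs', neg_zero]

/-- Bootstrapping: continuity of `x` and `y` makes them `C¹` by the equations, and then `ẋ` is `C¹`.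
-/
lemma contDiff_of_isHamiltonSolution {x y : ℝ → ℝ} (h : IsHamiltonSolution H x y) :
    ContDiff ℝ 2 x := by
  have hs := hH.isHamiltonSolution_iff.1 h
  have hx : Continuous x := continuous_iff_continuousAt.2 fun t => (hs t).1.continuousAt
  have hy : Continuous y := continuous_iff_continuousAt.2 fun t => (hs t).2.continuousAt
  have hxd : deriv x = fun t => velocity H ((t, x t), y t) := funext fun t => (hs t).1.deriv
  have hyd : deriv y = fun t => -fderiv ℝ (lift H) ((t, x t), y t) ((0, 1), 0) :=
    funext fun t => (hs t).2.deriv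
  have hv := contDiff_velocity hH.contDiff_lift
  have hx1 : ContDiff ℝ 1 x := by
    rw [contDiff_one_iff_deriv]
    refine ⟨fun t => (hs t).1.differentiableAt, ?_⟩
    rw [hxd]
    exact hv.continuous.comp (by fun_prop)
  have hy1 : ContDiff ℝ 1 y := by
    rw [contDiff_one_iff_deriv]
    refine ⟨fun t => (hs t).2.differentiableAt, ?_⟩
    rw [hyd]
    have := hH.contDiff_lift.continuous_fderiv (by simp)
    fun_prop
  rw [← one_add_one_eq_two, contDiff_succ_iff_deriv]
  refine ⟨fun t => (hs t).1.differentiableAt, by simp, ?_⟩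
  rw [hxd]
  exact (hv.of_le (by norm_cast)).comp ((contDiff_id.prodMk hx1).prodMk hy1)

end IsConvexHamiltonian

namespace IsAdmissible

variable {H : T2 → ℝ → ℝ} {D Dp Dm A B : ℝ} {hp hm : ℝ → ℝ}
  (ha : IsAdmissible H D Dp Dm A B hp hm)
include ha

lemma modified_base_indep (z z' : T2) {v : ℝ} (hv : D < |v|) :
    modifiedLagrangian H D hp hm z v = modifiedLagrangian H D hp hm z' v := by
  rcases lt_abs.1 hv with h | h
  · rw [ha.modified_of_lt z h, ha.modified_of_lt z' h]
  · rw [modifiedLagrangian_of_lt_neg z (by linarith),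
      modifiedLagrangian_of_lt_neg z' (by linarith)]

lemma deriv_modified_base_indep (z z' : T2) {v : ℝ} (hv : D < |v|) :
    deriv (modifiedLagrangian H D hp hm z) v = deriv (modifiedLagrangian H D hp hm z') v := by
  refine EventuallyEq.deriv_eq ?_
  filter_upwards [(continuous_abs.tendsto v).eventually (lt_mem_nhds hv)] with w hw
    using ha.modified_base_indep z z' hw

lemma deriv_modified_base_eq_zero (t x : ℝ) {v : ℝ} (hv : D < |v|) :
    deriv (fun x => modifiedLagrangian H D hp hm (projT (t, x)) v) x = 0 := by
  have : (fun x => modifiedLagrangian H D hp hm (projT (t, x)) v) =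
      fun _ => modifiedLagrangian H D hp hm (projT (t, x)) v :=
    funext fun x' => ha.modified_base_indep _ _ hv
  rw [this, deriv_const]

lemma strictMono_deriv_modified (z : T2) : StrictMono (deriv (modifiedLagrangian H D hp hm z)) :=
  strictMono_of_deriv_pos (ha.deriv2_modified_pos z)

lemma deriv_modified_base (t x : ℝ) {v : ℝ} (hv : |v| < D + 1) :
    deriv (fun x => modifiedLagrangian H D hp hm (projT (t, x)) v) x =
      -fderiv ℝ (lift H) ((t, x), momentum H ((t, x), v)) ((0, 1), 0) := by
  have heq : (fun x => modifiedLagrangian H D hp hm (projT (t, x)) v) =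
      fun x => lagrangian H ((t, x), v) := funext fun x' => ha.modified_of_abs_lt _ hv
  have h := (ha.ham.contDiff_lagrangian.differentiable (by simp)
    ((t, x), v)).hasFDerivAt.comp_hasDerivAt x
    (((hasDerivAt_const x t).prodMk (hasDerivAt_id x)).prodMk (hasDerivAt_const x v))
  rw [heq]
  refine h.deriv.trans ?_
  rw [ha.ham.fderiv_lagrangian]
  simp

/-- The solutions of the Euler–Lagrange equation of the modified Lagrangian are the solutions of
Hamilton's equations. -/
lemma isEulerLagrange_iff {θ : ℝ → ℝ} :
    IsEulerLagrange (fun t x v => modifiedLagrangian H D hp hm (projT (t, x)) v) θ ↔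
      ∃ y, IsHamiltonSolution H θ y := by
  have hD := ha.D_pos
  rw [isEulerLagrange_real_iff]
  constructor
  · rintro ⟨hθ, hEL⟩
    have hcd : Continuous (deriv θ) := hθ.continuous_deriv (by norm_num)
    have hθd : ∀ t, HasDerivAt θ (deriv θ t) t := fun t =>
      (hθ.differentiable (by norm_num) t).hasDerivAt
    refine ⟨fun t => momentum H ((t, θ t), deriv θ t), ha.ham.isHamiltonSolution_iff.2 fun t =>
      ⟨(hθd t).congr_deriv (ha.ham.velocity_momentum _ _).symm, ?_⟩⟩
    -- A velocity beyond `D` is constant: `∂_x L = 0` there, so `∂_v L` is conserved, and it is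
    -- strictly increasing in the velocity. Otherwise the whole curve stays where `L` is the dual of
    -- `H`.
    by_cases hcase : ∃ t₀, D < |deriv θ t₀|
    · obtain ⟨t₀, h₀⟩ := hcase
      have hconst : ∀ t, deriv θ t = deriv θ t₀ := by
        refine fun t => eq_const_of_locally_const hcd (fun t ht => ?_) rfl t
        have hev : ∀ᶠ s in 𝓝 t, D < |deriv θ s| :=
          (hcd.abs.tendsto t).eventually (lt_mem_nhds (by rwa [ht]))
        have hz : ∀ᶠ s in 𝓝 t,
            HasDerivAt (fun s => deriv (modifiedLagrangian H D hp hm 0) (deriv θ s)) 0 s := by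
          filter_upwards [hev.eventually_nhds] with s hs
          have h1 := hEL s
          rw [ha.deriv_modified_base_eq_zero _ _ hs.self_of_nhds] at h1
          refine h1.congr_of_eventuallyEq ?_
          filter_upwards [hs] with r hr using ha.deriv_modified_base_indep _ _ hr
        filter_upwards [eventually_eq_of_hasDerivAt_zero hz] with s hs
        rw [← ht]
        exact (ha.strictMono_deriv_modified 0).injective hs
      have hm : (fun t => momentum H ((t, θ t), deriv θ t)) = fun _ => deriv θ t₀ := by
        funext t
        rw [hconst t, ha.ham.momentum_of_lt_abs _ h₀]
      have hmt : momentum H ((t, θ t), deriv θ t) = deriv θ t₀ := congrFun hm t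
      rw [hm, hmt, ha.ham.fderiv_lift_base_eq_zero _ _ h₀, neg_zero]
      exact hasDerivAt_const _ _
    · push Not at hcase
      have h1 := hEL t
      rw [ha.deriv_modified_base _ _ (by linarith [hcase t])] at h1
      refine h1.congr_of_eventuallyEq (Eventually.of_forall fun s => ?_)
      exact (ha.deriv_modified_of_abs_lt _ (by linarith [hcase s])).symm
  · rintro ⟨y, hy⟩
    have hs := ha.ham.isHamiltonSolution_iff.1 hy
    refine ⟨ha.ham.contDiff_of_isHamiltonSolution hy, fun t => ?_⟩
    have hθd : ∀ t, deriv θ t = velocity H ((t, θ t), y t) := fun t => (hs t).1.deriv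
    -- The same dichotomy, now read off from conservation of the momentum.
    by_cases hcase : ∃ t₀, D < |y t₀|
    · obtain ⟨t₀, h₀⟩ := hcase
      have hd : ∀ t, deriv θ t = y t₀ := fun t => by
        rw [hθd, ha.ham.momentum_const hy h₀ t, ha.ham.velocity_of_lt_abs _ h₀]
      simp only [hd]
      rw [ha.deriv_modified_base_eq_zero _ _ h₀]
      refine (hasDerivAt_const t (deriv (modifiedLagrangian H D hp hm 0) (y t₀)))
        |>.congr_of_eventuallyEq (Eventually.of_forall fun s => ?_)
      exact ha.deriv_modified_base_indep _ _ h₀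
    · push Not at hcase
      have hle : ∀ t, |deriv θ t| < D + 1 := fun t => by
        rw [hθd]
        linarith [ha.ham.abs_velocity_le (p := (t, θ t)) (hcase t)]
      have hmom : ∀ t, momentum H ((t, θ t), deriv θ t) = y t := fun t => by
        rw [hθd, ha.ham.momentum_velocity]
      rw [ha.deriv_modified_base _ _ (hle t), hmom]
      refine (hs t).2.congr_of_eventuallyEq (Eventually.of_forall fun s => ?_)
      simp only
      rw [ha.deriv_modified_of_abs_lt _ (hle s), hmom]

end IsAdmissible

/-! ### Geodesics -/

/-- The energy `F² / 2`, lifted to the universal covering. -/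
def energy (F : T2 → ℝ × ℝ → ℝ) (w : (ℝ × ℝ) × (ℝ × ℝ)) : ℝ := (1 / 2) * F (projT w.1) w.2 ^ 2

/-- `c` is a lifted geodesic of `F`, parametrised proportionally to arc length. -/
def IsGeodesic (F : T2 → ℝ × ℝ → ℝ) (c : ℝ → ℝ × ℝ) : Prop :=
  IsEulerLagrange (fun _ x v => energy F (x, v)) c

namespace IsGeodesic

variable {F : T2 → ℝ × ℝ → ℝ} {c : ℝ → ℝ × ℝ} (hc : IsGeodesic F c)
include hc

lemma contDiff : ContDiff ℝ 2 c := hc.1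

lemma hasDerivAt (t : ℝ) : HasDerivAt c (deriv c t) t :=
  (hc.contDiff.differentiable (by norm_num) t).hasDerivAt

lemma contDiff_deriv : ContDiff ℝ 1 (deriv c) := by
  have h := hc.contDiff
  rw [← one_add_one_eq_two, contDiff_succ_iff_deriv] at h
  exact h.2.2

lemma continuous_deriv : Continuous (deriv c) := hc.contDiff_deriv.continuous

lemma hasDerivAt_deriv (t : ℝ) : HasDerivAt (deriv c) (deriv (deriv c) t) t :=
  (hc.contDiff_deriv.differentiable (by norm_num) t).hasDerivAt

/-- Translations by the lattice preserve geodesics. -/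
lemma add_const {k : ℝ × ℝ} (hk : ∀ x, projT (x + k) = projT x) :
    IsGeodesic F (fun t => c t + k) := by
  have hd : deriv (fun t => c t + k) = deriv c := funext fun t => deriv_add_const k
  refine ⟨hc.contDiff.add contDiff_const, fun t => ?_⟩
  rw [hd]
  have h2 : fderiv ℝ (fun x => energy F (x, deriv c t)) (c t + k) =
      fderiv ℝ (fun x => energy F (x, deriv c t)) (c t) := by
    rw [← fderiv_comp_add_right]
    simp only [energy, hk]
  rw [h2]
  have h := hc.2 t
  simp only [energy, hk] at h ⊢
  exact h

end IsGeodesic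

/-! ### Partial derivatives of the energy -/

section energy

variable {F : T2 → ℝ × ℝ → ℝ} {x v : ℝ × ℝ} (h : DifferentiableAt ℝ (energy F) (x, v))
include h

lemma fderiv_energy_fibre (u : ℝ × ℝ) :
    fderiv ℝ (fun v => energy F (x, v)) v u = fderiv ℝ (energy F) (x, v) (0, u) := by
  have h1 := h.hasFDerivAt.comp v ((hasFDerivAt_const x v).prodMk (hasFDerivAt_id v))
  have h2 : fderiv ℝ (fun v => energy F (x, v)) v = _ := h1.fderiv
  rw [h2]
  simp

lemma fderiv_energy_base (u : ℝ × ℝ) :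
    fderiv ℝ (fun x => energy F (x, v)) x u = fderiv ℝ (energy F) (x, v) (u, 0) := by
  have h0 : HasFDerivAt (fun x : ℝ × ℝ => (x, v)) _ x :=
    (hasFDerivAt_id (𝕜 := ℝ) x).prodMk (hasFDerivAt_const v x)
  have h1 := h.hasFDerivAt.comp x h0
  have h2 : fderiv ℝ (fun x => energy F (x, v)) x = _ := h1.fderiv
  rw [h2]
  simp

end energy

/-- The vector field on the space of momenta of norm one whose integral curves project to the unit
speed geodesics in the cone `|v₂| ≤ D v₁`. -/
def geodesicField (H : T2 → ℝ → ℝ) (q : (ℝ × ℝ) × ℝ) : (ℝ × ℝ) × ℝ :=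
  (lagrangian H (q.1, velocity H q))⁻¹ •
    (((1, velocity H q), -fderiv ℝ (lift H) q ((0, 1), 0)) : (ℝ × ℝ) × ℝ)

namespace IsAdmissible

variable {H : T2 → ℝ → ℝ} {D Dp Dm A B : ℝ} {hp hm : ℝ → ℝ}
  (ha : IsAdmissible H D Dp Dm A B hp hm)
include ha

local notation "𝓕" => finslerOf A B (modifiedLagrangian H D hp hm)

lemma differentiableAt_energy (x : ℝ × ℝ) {v : ℝ × ℝ} (hv : v ≠ 0) :
    DifferentiableAt ℝ (energy 𝓕) (x, v) :=
  ((contDiffAt_const.mul ((ha.finsler_contDiffAt (w := (x, v)) hv).pow 2)).differentiableAt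
    (by simp) :)

omit ha in
lemma _root_.FinslerTwist.finslerOf_zero {L : T2 → ℝ → ℝ} (z : T2) : finslerOf A B L z 0 = 0 := by
  rw [finslerOf_of_nonpos z le_rfl]; simp

/-- Euler's relation for the energy, which is homogeneous of degree two. -/
lemma fderiv_energy_self (x v : ℝ × ℝ) :
    fderiv ℝ (fun v => energy 𝓕 (x, v)) v v = 𝓕 (projT x) v ^ 2 := by
  -- At `v = 0` both sides vanish without any differentiability of the energy.
  rcases eq_or_ne v 0 with rfl | hv
  · rw [finslerOf_zero]; simp
  have hd : DifferentiableAt ℝ (fun v => energy 𝓕 (x, v)) v :=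
    (ha.differentiableAt_energy x hv).comp v (by fun_prop)
  have hline : HasDerivAt (fun r : ℝ => r • v) v 1 := by
    simpa using (hasDerivAt_id (1 : ℝ)).smul_const v
  have h1 := hd.hasFDerivAt.comp_hasDerivAt_of_eq (1 : ℝ) hline (by simp)
  refine h1.unique ?_
  have h2 : HasDerivAt (fun r : ℝ => (1 / 2) * (r * 𝓕 (projT x) v) ^ 2) (𝓕 (projT x) v ^ 2) 1 := by
    refine ((((hasDerivAt_id (1 : ℝ)).mul_const (𝓕 (projT x) v)).pow 2).const_mul
      (1 / 2)).congr_deriv ?_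
    simp
    ring
  refine h2.congr_of_eventuallyEq ?_
  filter_upwards [lt_mem_nhds (zero_lt_one' ℝ)] with r hr
  simp only [Function.comp_apply, energy]
  rw [ha.isFinsler.homogeneous _ _ r hr]

/-- The norm of the velocity of a geodesic is constant. -/
lemma finsler_deriv_eq_one {c : ℝ → ℝ × ℝ} (hc : IsGeodesic 𝓕 c)
    (h₀ : 𝓕 (projT (c 0)) (deriv c 0) = 1) (t : ℝ) : 𝓕 (projT (c t)) (deriv c t) = 1 := by
  set P : ℝ → (ℝ × ℝ →L[ℝ] ℝ) := fun s => fderiv ℝ (fun v => energy 𝓕 (c s, v)) (deriv c s) with hP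
  have hPd : ∀ s, HasDerivAt P (fderiv ℝ (fun x => energy 𝓕 (x, deriv c s)) (c s)) s := hc.2
  have hPc : Continuous P := continuous_iff_continuousAt.2 fun s => (hPd s).continuousAt
  have he : ∀ s, 𝓕 (projT (c s)) (deriv c s) ^ 2 = P s (deriv c s) := fun s =>
    (ha.fderiv_energy_self _ _).symm
  have hec : Continuous fun s => P s (deriv c s) := hPc.clm_apply hc.continuous_deriv
  -- Where the value is `1` the velocity is nonzero, so the energy is differentiable nearby. Then `P
  -- ċ = F²` is twice the energy by Euler's relation, while the equation of motion gives it the same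
  -- derivative as the energy; hence that derivative is zero.
  have hone : P t (deriv c t) = 1 := by
    refine eq_const_of_locally_const hec (fun t ht => ?_) (by rw [← he, h₀, one_pow] : _ = _) t
    have hne : deriv c t ≠ 0 := by
      intro h
      rw [h, map_zero] at ht
      exact zero_ne_one ht
    have hev : ∀ᶠ s in 𝓝 t, deriv c s ≠ 0 :=
      (hc.continuous_deriv.tendsto t).eventually (isOpen_ne.mem_nhds hne)
    have hz : ∀ᶠ s in 𝓝 t, HasDerivAt (fun s => P s (deriv c s)) 0 s := by
      filter_upwards [hev] with s hs
      have hdiff := ha.differentiableAt_energy (c s) hs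
      have h1 := (hPd s).clm_apply (hc.hasDerivAt_deriv s)
      have h2 :=
        hdiff.hasFDerivAt.comp_hasDerivAt s ((hc.hasDerivAt s).prodMk (hc.hasDerivAt_deriv s))
      have h3 : HasDerivAt (fun s => P s (deriv c s)) _ s :=
        (h2.const_mul 2).congr_of_eventuallyEq (Eventually.of_forall fun r => by
          simp only [energy, Function.comp_apply]
          rw [← he]
          ring)
      have h4 := h1.unique h3
      have h5 : fderiv ℝ (energy 𝓕) (c s, deriv c s) (deriv c s, deriv (deriv c) s) =
          fderiv ℝ (energy 𝓕) (c s, deriv c s) (deriv c s, 0) +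
          fderiv ℝ (energy 𝓕) (c s, deriv c s) (0, deriv (deriv c) s) := by
        rw [← map_add]; simp
      rw [hP, h5] at h4
      simp only [fderiv_energy_base hdiff, fderiv_energy_fibre hdiff] at h4
      refine h3.congr_deriv ?_
      rw [h5]
      linarith
    filter_upwards [eventually_eq_of_hasDerivAt_zero hz] with s hs
    rw [hs, ht]
  have hnn := ha.isFinsler.nonneg (projT (c t)) (deriv c t)
  rw [← he] at hone
  nlinarith

lemma energy_base_indep (x x' : ℝ × ℝ) {v : ℝ × ℝ} (hv : D * v.1 < |v.2|) :
    energy 𝓕 (x, v) = energy 𝓕 (x', v) := by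
  simp only [energy]
  rw [ha.finsler_base_indep (projT x) (projT x') hv]

omit ha in
lemma _root_.FinslerTwist.isOpen_outer (D : ℝ) : IsOpen {v : ℝ × ℝ | D * v.1 < |v.2|} :=
  isOpen_lt (by fun_prop) (by fun_prop)

omit ha in
lemma _root_.FinslerTwist.ne_zero_of_outer {v : ℝ × ℝ} (hv : D * v.1 < |v.2|) : v ≠ 0 := by
  rintro rfl
  simp at hv

lemma fderiv_energy_base_eq_zero (x : ℝ × ℝ) {v : ℝ × ℝ} (hv : D * v.1 < |v.2|) :
    fderiv ℝ (fun x => energy 𝓕 (x, v)) x = 0 := by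
  have : (fun x => energy 𝓕 (x, v)) = fun _ => energy 𝓕 (x, v) :=
    funext fun x' => ha.energy_base_indep _ _ hv
  rw [this, fderiv_const_apply]

lemma fderiv_energy_fibre_indep (x x' : ℝ × ℝ) {v : ℝ × ℝ} (hv : D * v.1 < |v.2|) :
    fderiv ℝ (fun v => energy 𝓕 (x, v)) v = fderiv ℝ (fun v => energy 𝓕 (x', v)) v := by
  refine EventuallyEq.fderiv_eq ?_
  filter_upwards [(isOpen_outer D).mem_nhds hv] with u hu using ha.energy_base_indep _ _ hu

/-- Straight lines in directions off the cone `|v₂| ≤ D v₁` are geodesics. -/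
lemma isGeodesic_line (p : ℝ × ℝ) {v : ℝ × ℝ} (hv : D * v.1 < |v.2|) :
    IsGeodesic 𝓕 (fun s => p + s • v) := by
  have hd : ∀ s, deriv (fun s : ℝ => p + s • v) s = v := fun s => by
    have : HasDerivAt (fun s : ℝ => p + s • v) v s := by
      simpa using ((hasDerivAt_id s).smul_const v).const_add p
    exact this.deriv
  refine ⟨by fun_prop, fun t => ?_⟩
  simp only [hd]
  rw [ha.fderiv_energy_base_eq_zero _ hv]
  refine (hasDerivAt_const t (fderiv ℝ (fun v => energy 𝓕 (p, v)) v)).congr_of_eventuallyEq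
    (Eventually.of_forall fun s => ?_)
  exact ha.fderiv_energy_fibre_indep _ _ hv

/-- A geodesic with a velocity off the cone `|v₂| ≤ D v₁` is a straight line. -/
lemma deriv_const_of_outer {c : ℝ → ℝ × ℝ} (hc : IsGeodesic 𝓕 c) {t₀ : ℝ}
    (h₀ : D * (deriv c t₀).1 < |(deriv c t₀).2|) (t : ℝ) : deriv c t = deriv c t₀ := by
  refine eq_const_of_locally_const hc.continuous_deriv (fun t ht => ?_) rfl t
  have hev : ∀ᶠ s in 𝓝 t, D * (deriv c s).1 < |(deriv c s).2| :=
    (hc.continuous_deriv.tendsto t).eventually ((isOpen_outer D).mem_nhds (by rw [ht]; exact h₀))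
  rw [← ht]
  refine eventually_eq_of_hasDerivAt_zero ?_
  filter_upwards [hev.eventually_nhds] with s hs
  have hne := ne_zero_of_outer hs.self_of_nhds
  -- The energy with base point frozen. The equation of motion becomes `D²Q(ċ) c̈ = 0`, and
  -- definiteness of the Hessian gives `c̈ = 0`.
  set Q : ℝ × ℝ → ℝ := fun v => (1 / 2) * 𝓕 (projT 0) v ^ 2 with hQ
  have hQd : DifferentiableAt ℝ (fderiv ℝ Q) (deriv c s) :=
    ((contDiffAt_const.mul ((ha.finsler_contDiffAt_fibre (projT 0) hne).pow 2)).fderiv_right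
      (m := ∞) (by simp)).differentiableAt (by simp)
  have h1 := hQd.hasFDerivAt.comp_hasDerivAt s (hc.hasDerivAt_deriv s)
  have h2 := hc.2 s
  rw [ha.fderiv_energy_base_eq_zero _ hs.self_of_nhds] at h2
  have h3 := h1.unique (h2.congr_of_eventuallyEq (by
    filter_upwards [hs] with r hr using ha.fderiv_energy_fibre_indep 0 (c r) hr))
  have h4 : deriv (deriv c) s = 0 := by
    by_contra hcon
    have h5 := ha.energy_hessian_pos (projT 0) hne hcon
    have h6 : fderiv ℝ (fderiv ℝ Q) (deriv c s) (deriv (deriv c) s) (deriv (deriv c) s) = 0 := by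
      rw [h3]; rfl
    exact h5.ne' h6
  rw [← h4]
  exact hc.hasDerivAt_deriv s

lemma finsler_cone (p : ℝ × ℝ) {v : ℝ × ℝ} (hv : 0 < v.1) (hs : |v.2 / v.1| < D + 1) :
    𝓕 (projT p) v = v.1 * lagrangian H (p, v.2 / v.1) := by
  rw [finslerOf_of_pos _ hv, ha.modified_of_abs_lt p hs]

/-- The derivative of the energy near the cone `|v₂| ≤ D v₁`. -/
lemma fderiv_energy_cone (p : ℝ × ℝ) {v : ℝ × ℝ} (hv : 0 < v.1) (hs : |v.2 / v.1| < D + 1)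
    (a b : ℝ × ℝ) : fderiv ℝ (energy 𝓕) (p, v) (a, b) =
      𝓕 (projT p) v * (momentum H (p, v.2 / v.1) * b.2 -
        lift H (p, momentum H (p, v.2 / v.1)) * b.1 -
        v.1 * fderiv ℝ (lift H) (p, momentum H (p, v.2 / v.1)) (a, 0)) := by
  have hne : v ≠ 0 := by rintro rfl; simp at hv
  have hpl : HasDerivAt (fun s : ℝ => p + s • a) a 0 := by
    simpa using ((hasDerivAt_id (0 : ℝ)).smul_const a).const_add p
  have hvl : HasDerivAt (fun s : ℝ => v + s • b) b 0 := by
    simpa using ((hasDerivAt_id (0 : ℝ)).smul_const b).const_add v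
  have h1 := (ha.differentiableAt_energy p hne).hasFDerivAt.comp_hasDerivAt_of_eq (0 : ℝ)
    (hpl.prodMk hvl) (by simp)
  refine h1.unique ?_
  have hlin₁ : HasDerivAt (fun s : ℝ => v.1 + s * b.1) b.1 0 := by
    simpa using ((hasDerivAt_id (0 : ℝ)).mul_const b.1).const_add v.1
  have hlin₂ : HasDerivAt (fun s : ℝ => v.2 + s * b.2) b.2 0 := by
    simpa using ((hasDerivAt_id (0 : ℝ)).mul_const b.2).const_add v.2
  have hm := hlin₂.div hlin₁ (by simpa using hv.ne')
  have hl := (ha.ham.contDiff_lagrangian.differentiable (by simp)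
    (p, v.2 / v.1)).hasFDerivAt.comp_hasDerivAt_of_eq (0 : ℝ) (hpl.prodMk hm) (by simp)
  have hF := ((hlin₁.mul hl).pow 2).const_mul (1 / 2)
  rw [ha.finsler_cone p hv hs]
  have hval : ∀ᶠ s in 𝓝 (0 : ℝ), 0 < (v + s • b).1 ∧ |(v + s • b).2 / (v + s • b).1| < D + 1 := by
    have hc1 : ContinuousAt (fun s : ℝ => (v + s • b).1) 0 := by fun_prop
    have hc2 : ContinuousAt (fun s : ℝ => |(v + s • b).2 / (v + s • b).1|) 0 :=
      (ContinuousAt.div (by fun_prop) hc1 (by simpa using hv.ne')).abs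
    exact (hc1.tendsto.eventually (lt_mem_nhds (by simpa using hv))).and
      (hc2.tendsto.eventually (gt_mem_nhds (by simpa using hs)))
  refine (hF.congr_deriv ?_).congr_of_eventuallyEq ?_
  · simp only [zero_mul, add_zero, Function.comp_apply, Pi.mul_apply, Pi.div_apply, zero_smul,
      ha.ham.fderiv_lagrangian]
    have hl' : lift H (p, momentum H (p, v.2 / v.1)) =
      momentum H (p, v.2 / v.1) * (v.2 / v.1) - lagrangian H (p, v.2 / v.1) := by
      rw [lagrangian]; ring
    rw [hl']
    field_simp
    push_cast
    ring
  · filter_upwards [hval] with s hs'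
    simp only [Function.comp_apply, energy, Pi.mul_apply, Pi.pow_apply, Pi.div_apply]
    rw [ha.finsler_cone _ hs'.1 hs'.2]
    simp

/-- The conjugate momentum of a unit vector is `(-H, y)`: the unit cosphere is here the graph of
`-H`, which brings the Hamiltonian into the geodesic flow. -/
lemma fderiv_energy_fibre_cone (p : ℝ × ℝ) {v : ℝ × ℝ} (hv : 0 < v.1) (hs : |v.2 / v.1| < D + 1)
    (h1 : 𝓕 (projT p) v = 1) : fderiv ℝ (fun v => energy 𝓕 (p, v)) v =
      momentum H (p, v.2 / v.1) • ContinuousLinearMap.snd ℝ ℝ ℝ -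
        lift H (p, momentum H (p, v.2 / v.1)) • ContinuousLinearMap.fst ℝ ℝ ℝ := by
  have hne : v ≠ 0 := by rintro rfl; simp at hv
  refine ContinuousLinearMap.ext fun u => ?_
  rw [fderiv_energy_fibre (ha.differentiableAt_energy p hne), ha.fderiv_energy_cone p hv hs, h1]
  simp [show (((0 : ℝ × ℝ), (0 : ℝ)) : (ℝ × ℝ) × ℝ) = 0 from rfl]

lemma fderiv_energy_base_cone (p : ℝ × ℝ) {v : ℝ × ℝ} (hv : 0 < v.1) (hs : |v.2 / v.1| < D + 1)
    (h1 : 𝓕 (projT p) v = 1) (u : ℝ × ℝ) : fderiv ℝ (fun x => energy 𝓕 (x, v)) p u =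
      -(v.1 * fderiv ℝ (lift H) (p, momentum H (p, v.2 / v.1)) (u, 0)) := by
  have hne : v ≠ 0 := by rintro rfl; simp at hv
  rw [fderiv_energy_base (ha.differentiableAt_energy p hne), ha.fderiv_energy_cone p hv hs, h1]
  simp

lemma contDiff_geodesicField : ContDiff ℝ ∞ (geodesicField H) := by
  have hv := contDiff_velocity ha.ham.contDiff_lift
  refine ContDiff.smul (ContDiff.inv (ha.ham.contDiff_lagrangian.comp (contDiff_fst.prodMk hv))
    fun q => (ha.lagrangian_pos _).ne') ?_
  exact (contDiff_const.prodMk hv).prodMk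
    ((ha.ham.contDiff_lift.fderiv_right (m := ∞) (by simp)).clm_apply contDiff_const).neg

/-! ### Geodesics in the cone as integral curves -/

section integralCurve

variable {γ : ℝ → (ℝ × ℝ) × ℝ} (hγ : ∀ t, HasDerivAt γ (geodesicField H (γ t)) t)
include hγ

omit ha in
lemma _root_.FinslerTwist.hasDerivAt_fst_of_integralCurve (t : ℝ) : HasDerivAt (fun t => (γ t).1)
    ((lagrangian H ((γ t).1, velocity H (γ t)))⁻¹ • (1, velocity H (γ t))) t :=
  (ContinuousLinearMap.fst ℝ (ℝ × ℝ) ℝ).hasFDerivAt.comp_hasDerivAt t (hγ t)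

omit ha in
lemma _root_.FinslerTwist.hasDerivAt_snd_of_integralCurve (t : ℝ) : HasDerivAt (fun t => (γ t).2)
    ((lagrangian H ((γ t).1, velocity H (γ t)))⁻¹ * -fderiv ℝ (lift H) (γ t) ((0, 1), 0)) t :=
  (ContinuousLinearMap.snd ℝ (ℝ × ℝ) ℝ).hasFDerivAt.comp_hasDerivAt t (hγ t)

/-- The region `|y| ≤ D` is invariant. -/
lemma abs_snd_le_of_integralCurve (h₀ : |(γ 0).2| ≤ D) (t : ℝ) : |(γ t).2| ≤ D := by
  by_contra! hcon
  have hc : Continuous γ := continuous_iff_continuousAt.2 fun t => (hγ t).continuousAt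
  have hconst : ∀ s, (γ s).2 = (γ t).2 := by
    refine fun s => eq_const_of_locally_const hc.snd (fun r hr => ?_) rfl s
    have hev : ∀ᶠ s in 𝓝 r, D < |(γ s).2| :=
      (hc.snd.abs.tendsto r).eventually (lt_mem_nhds (by rwa [hr]))
    rw [← hr]
    refine eventually_eq_of_hasDerivAt_zero ?_
    filter_upwards [hev] with s hs
    refine (hasDerivAt_snd_of_integralCurve hγ s).congr_deriv ?_
    have := ha.ham.fderiv_lift_base_eq_zero (γ s).1 (0, 1) hs
    rw [Prod.mk.eta] at this
    rw [this, neg_zero, mul_zero]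
  rw [hconst 0] at h₀
  linarith

/-- Integral curves in `|y| ≤ D` project to unit speed geodesics. -/
lemma isGeodesic_of_integralCurve (h₀ : |(γ 0).2| ≤ D) : IsGeodesic 𝓕 (fun t => (γ t).1) := by
  have hle := ha.abs_snd_le_of_integralCurve hγ h₀
  have hcont : Continuous γ := continuous_iff_continuousAt.2 fun t => (hγ t).continuousAt
  have hγd : deriv γ = fun t => geodesicField H (γ t) := funext fun t => (hγ t).deriv
  have hX := ha.contDiff_geodesicField
  have hγ1 : ContDiff ℝ 1 γ := by
    rw [contDiff_one_iff_deriv]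
    refine ⟨fun t => (hγ t).differentiableAt, ?_⟩
    rw [hγd]
    exact hX.continuous.comp hcont
  have hγ2 : ContDiff ℝ 2 γ := by
    rw [← one_add_one_eq_two, contDiff_succ_iff_deriv]
    refine ⟨fun t => (hγ t).differentiableAt, by simp, ?_⟩
    rw [hγd]
    exact (hX.of_le (by norm_cast)).comp hγ1
  refine ⟨contDiff_fst.comp hγ2, fun t => ?_⟩
  have hd : deriv (fun t => (γ t).1) =
      fun t => (lagrangian H ((γ t).1, velocity H (γ t)))⁻¹ • (1, velocity H (γ t)) :=
    funext fun t => (hasDerivAt_fst_of_integralCurve hγ t).deriv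
  have hℓ := fun t => ha.lagrangian_pos ((γ t).1, velocity H (γ t))
  have hpos : ∀ t, 0 < (deriv (fun t => (γ t).1) t).1 := fun t => by
    rw [hd]; simpa using hℓ t
  have hslope : ∀ t, (deriv (fun t => (γ t).1) t).2 / (deriv (fun t => (γ t).1) t).1 =
      velocity H (γ t) := fun t => by
    have := (hℓ t).ne'
    rw [hd]; simp; field_simp
  have habs : ∀ t, |(deriv (fun t => (γ t).1) t).2 / (deriv (fun t => (γ t).1) t).1| < D + 1 :=
    fun t => by
      rw [hslope]
      have := ha.ham.abs_velocity_le (p := (γ t).1) (hle t)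
      rw [Prod.mk.eta] at this
      linarith
  have hmom : ∀ t, momentum H ((γ t).1, velocity H (γ t)) = (γ t).2 := fun t =>
    ha.ham.momentum_velocity (γ t).1 (γ t).2
  have hone : ∀ t, 𝓕 (projT (γ t).1) (deriv (fun t => (γ t).1) t) = 1 := fun t => by
    rw [ha.finsler_cone _ (hpos t) (habs t), hslope, hd]
    have := (hℓ t).ne'
    simp [this]
  have hfun : (fun s => fderiv ℝ (fun v => energy 𝓕 ((γ s).1, v)) (deriv (fun t => (γ t).1) s)) =
      fun s => (γ s).2 • ContinuousLinearMap.snd ℝ ℝ ℝ -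
        lift H (γ s) • ContinuousLinearMap.fst ℝ ℝ ℝ := funext fun s => by
    rw [ha.fderiv_energy_fibre_cone _ (hpos s) (habs s) (hone s), hslope, hmom]
  simp only [] at hfun ⊢
  rw [hfun]
  have hlift := (differentiable_lift ha.ham.contDiff_lift (γ t)).hasFDerivAt.comp_hasDerivAt t
    (hγ t)
  refine (((hasDerivAt_snd_of_integralCurve hγ t).smul_const _).sub
    (hlift.smul_const _)).congr_deriv ?_
  refine ContinuousLinearMap.ext fun u => ?_
  rw [ha.fderiv_energy_base_cone _ (hpos t) (habs t) (hone t), hslope, hmom, hd]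
  set dH := fderiv ℝ (lift H) (γ t) with hdH
  set ℓ := (lagrangian H ((γ t).1, velocity H (γ t)))⁻¹ with hℓdef
  -- Along the field the `x` and `y` contributions to `dH` cancel, leaving only the explicit time
  -- derivative.
  have e1 : dH (geodesicField H (γ t)) = ℓ * dH ((1, 0), 0) := by
    have : geodesicField H (γ t) = ℓ • (((1, 0), 0) : (ℝ × ℝ) × ℝ) +
        (ℓ * velocity H (γ t)) • (((0, 1), 0) : (ℝ × ℝ) × ℝ) +
        (ℓ * -dH ((0, 1), 0)) • (((0, 0), 1) : (ℝ × ℝ) × ℝ) := by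
      simp [geodesicField, hℓdef, hdH]
    rw [this]
    simp only [map_add, map_smul, smul_eq_mul]
    have hv : dH ((0, 0), 1) = velocity H (γ t) := rfl
    rw [hv]
    ring
  have e2 : dH (u, 0) = u.1 * dH ((1, 0), 0) + u.2 * dH ((0, 1), 0) := by
    have : ((u, 0) : (ℝ × ℝ) × ℝ) = u.1 • (((1, 0), 0) : (ℝ × ℝ) × ℝ) +
        u.2 • (((0, 1), 0) : (ℝ × ℝ) × ℝ) := by simp
    rw [this]
    simp only [map_add, map_smul, smul_eq_mul]
  rw [e1]
  simp only [sub_apply, smul_apply,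
    ContinuousLinearMap.coe_snd', ContinuousLinearMap.coe_fst', smul_eq_mul, Prod.smul_fst,
    mul_one]
  rw [← hℓdef, e2]
  ring

end integralCurve

/-- Unit speed geodesics with velocities in the cone `|v₂| ≤ D v₁` come from integral curves. -/
lemma integralCurve_of_isGeodesic {c : ℝ → ℝ × ℝ} (hc : IsGeodesic 𝓕 c)
    (h₁ : ∀ t, 𝓕 (projT (c t)) (deriv c t) = 1) (hpos : ∀ t, 0 < (deriv c t).1)
    (hle : ∀ t, |(deriv c t).2 / (deriv c t).1| ≤ D) (t : ℝ) :
    HasDerivAt (fun t => (c t, momentum H (c t, (deriv c t).2 / (deriv c t).1)))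
      (geodesicField H (c t, momentum H (c t, (deriv c t).2 / (deriv c t).1))) t := by
  have hlt : ∀ t, |(deriv c t).2 / (deriv c t).1| < D + 1 := fun t => by linarith [hle t]
  -- Testing on `(0, 1)` extracts the equation for the momentum `y`, the second component of `(-H,
  -- y)`.
  have hP := (hc.2 t).clm_apply (hasDerivAt_const t ((0, 1) : ℝ × ℝ))
  have hmom : HasDerivAt (fun t => momentum H (c t, (deriv c t).2 / (deriv c t).1)) _ t :=
    hP.congr_of_eventuallyEq (Eventually.of_forall fun s => by
      simp only []
      rw [ha.fderiv_energy_fibre_cone _ (hpos s) (hlt s) (h₁ s)]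
      simp)
  refine ((hc.hasDerivAt t).prodMk hmom).congr_deriv ?_
  have hn := h₁ t
  rw [ha.finsler_cone _ (hpos t) (hlt t)] at hn
  -- Unit speed means `v₁ L = 1`, so the rescaling factor of the field is `v₁`.
  have hinv : (lagrangian H (c t, (deriv c t).2 / (deriv c t).1))⁻¹ = (deriv c t).1 :=
    (eq_inv_of_mul_eq_one_left hn).symm
  rw [geodesicField, ha.ham.velocity_momentum, hinv,
    ha.fderiv_energy_base_cone _ (hpos t) (hlt t) (h₁ t)]
  have := (hpos t).ne'
  ext <;> simp
  field_simp

end IsAdmissible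

/-! ### The geodesic flow -/

lemma projT_add (p k : ℝ × ℝ) : projT (p + k) = projT p + projT k := rfl

lemma projT_sub (p k : ℝ × ℝ) : projT (p - k) = projT p - projT k := rfl

lemma coe_int_eq_zero (n : ℤ) : ((n : ℝ) : S1) = 0 :=
  (AddCircle.coe_eq_zero_iff (1 : ℝ)).2 ⟨n, by simp⟩

lemma projT_int (a b : ℤ) : projT (a, b) = 0 := by
  simp only [projT, coe_int_eq_zero]
  rfl

lemma projT_add_of_eq_zero {k : ℝ × ℝ} (hk : projT k = 0) (p : ℝ × ℝ) :
    projT (p + k) = projT p := by rw [projT_add, hk, add_zero]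

/-! ### Invariance under the lattice -/

section periodic

variable {H : T2 → ℝ → ℝ} {k : ℝ × ℝ} (hk : projT k = 0)
include hk

lemma lift_add (q : (ℝ × ℝ) × ℝ) : lift H (q + (k, 0)) = lift H q := by
  simp [lift, projT_add, hk]

lemma fderiv_lift_add (q : (ℝ × ℝ) × ℝ) :
    fderiv ℝ (lift H) (q + (k, 0)) = fderiv ℝ (lift H) q := by
  rw [← fderiv_comp_add_right]
  simp only [lift_add hk]

lemma velocity_add (q : (ℝ × ℝ) × ℝ) : velocity H (q + (k, 0)) = velocity H q := by
  rw [velocity, fderiv_lift_add hk, velocity]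

lemma IsConvexHamiltonian.geodesicField_add {D Dp Dm : ℝ} (hH : IsConvexHamiltonian H D Dp Dm)
    (q : (ℝ × ℝ) × ℝ) : geodesicField H (q + (k, 0)) = geodesicField H q := by
  have : lagrangian H ((q + (k, 0)).1, velocity H q) = lagrangian H (q.1, velocity H q) := by
    -- `legendreDual` lives on the torus, so passing through it gives periodicity.
    rw [← hH.legendreDual_eq, ← hH.legendreDual_eq, Prod.fst_add, projT_add_of_eq_zero hk]
  rw [geodesicField, velocity_add hk, fderiv_lift_add hk, this, geodesicField]

end periodic

namespace IsAdmissible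

variable {H : T2 → ℝ → ℝ} {D Dp Dm A B : ℝ} {hp hm : ℝ → ℝ}
  (ha : IsAdmissible H D Dp Dm A B hp hm)
include ha

local notation "𝓕" => finslerOf A B (modifiedLagrangian H D hp hm)

/-- For `|y| > D` the field depends on `y` alone and does not change it, so its integral curves are
straight lines. -/
lemma geodesicField_outer (p : ℝ × ℝ) {y : ℝ} (hy : D < |y|) :
    geodesicField H (p, y) = (y ^ 2 - lift H (0, y))⁻¹ • (((1, y), 0) : (ℝ × ℝ) × ℝ) := by
  rw [geodesicField, ha.ham.velocity_of_lt_abs p hy, ha.ham.fderiv_lift_base_eq_zero p _ hy,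
    lagrangian, ha.ham.momentum_of_lt_abs p hy, ha.ham.lift_base_indep p 0 hy, neg_zero, sq]

/-- The geodesic field is complete. -/
lemma exists_integralCurve (q : (ℝ × ℝ) × ℝ) :
    ∃ γ : ℝ → (ℝ × ℝ) × ℝ, γ 0 = q ∧ ∀ t, HasDerivAt γ (geodesicField H (γ t)) t := by
  have hX1 : ContDiff ℝ 1 (geodesicField H) := ha.contDiff_geodesicField.of_le (by norm_cast)
  -- Local existence and compactness of a fundamental domain times `[-D, D]` give a uniform
  -- existence time.
  have hcompact : ∃ ε > (0 : ℝ), ∀ q ∈ (Icc (0 : ℝ) 1 ×ˢ Icc (0 : ℝ) 1) ×ˢ Icc (-D) D,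
      ∃ γ : ℝ → (ℝ × ℝ) × ℝ, γ 0 = q ∧
        ∀ t ∈ Ioo (-ε) ε, HasDerivAt γ (geodesicField H (γ t)) t := by
    refine ((isCompact_Icc.prod isCompact_Icc).prod isCompact_Icc).induction_on
      (p := fun S => ∃ ε > (0 : ℝ), ∀ q ∈ S, ∃ γ : ℝ → (ℝ × ℝ) × ℝ, γ 0 = q ∧
        ∀ t ∈ Ioo (-ε) ε, HasDerivAt γ (geodesicField H (γ t)) t) ?_ ?_ ?_ ?_
    · exact ⟨1, one_pos, fun q hq => absurd hq (notMem_empty q)⟩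
    · rintro S T hST ⟨ε, hε, h⟩
      exact ⟨ε, hε, fun q hq => h q (hST hq)⟩
    · rintro S T ⟨ε, hε, h⟩ ⟨δ, hδ, h'⟩
      refine ⟨min ε δ, lt_min hε hδ, fun q hq => ?_⟩
      rcases hq with hq | hq
      · obtain ⟨γ, h0, hγ⟩ := h q hq
        exact ⟨γ, h0, fun t ht => hγ t ⟨by linarith [ht.1, min_le_left ε δ],
          ht.2.trans_le (min_le_left ε δ)⟩⟩
      · obtain ⟨γ, h0, hγ⟩ := h' q hq
        exact ⟨γ, h0, fun t ht => hγ t ⟨by linarith [ht.1, min_le_right ε δ],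
          ht.2.trans_le (min_le_right ε δ)⟩⟩
    · intro q _
      obtain ⟨r, hr, ε, hε, h⟩ := hX1.contDiffAt (x := q)
        |>.exists_forall_mem_closedBall_exists_eq_forall_mem_Ioo_hasDerivAt 0
      refine ⟨Metric.closedBall q r, mem_nhdsWithin_of_mem_nhds (Metric.closedBall_mem_nhds q hr),
        ε, hε, fun q' hq' => ?_⟩
      simpa using h q' hq'
  obtain ⟨ε, hε, hlocal⟩ := hcompact
  refine exists_integralCurve_of_uniform_time hX1 hε (fun q => ?_) q
  rcases lt_or_ge D |q.2| with hq | hq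
  · refine ⟨fun t => q + t • geodesicField H q, by simp, fun t _ => ?_⟩
    have hconst : geodesicField H (q + t • geodesicField H q) = geodesicField H q := by
      have h2 : (q + t • geodesicField H q).2 = q.2 := by
        rw [← Prod.mk.eta (p := q), ha.geodesicField_outer q.1 hq]
        simp
      rw [← Prod.mk.eta (p := q + t • geodesicField H q), h2, ha.geodesicField_outer _ hq,
        ← ha.geodesicField_outer q.1 hq]
    rw [hconst]
    simpa using ((hasDerivAt_id t).smul_const (geodesicField H q)).const_add q
  -- Translate into the fundamental domain by integer parts, solve there, and translate back.
  · set k : ℝ × ℝ := ((⌊q.1.1⌋ : ℝ), (⌊q.1.2⌋ : ℝ)) with hkdef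
    have hk : projT k = 0 := projT_int _ _
    obtain ⟨γ, h0, hγ⟩ := hlocal (q - (k, 0)) (by
      refine ⟨⟨⟨?_, ?_⟩, ⟨?_, ?_⟩⟩, ?_⟩
      · simp [hkdef]
      · simpa [hkdef] using (Int.fract_lt_one q.1.1).le
      · simp [hkdef]
      · simpa [hkdef] using (Int.fract_lt_one q.1.2).le
      · simpa using abs_le.1 hq)
    refine ⟨fun t => γ t + (k, 0), by simp [h0], fun t ht => ?_⟩
    rw [ha.ham.geodesicField_add hk]
    exact (hγ t ht).add_const _

omit ha in
lemma _root_.FinslerTwist.projTT_surjective : Function.Surjective projTT := by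
  rintro ⟨z, v⟩
  obtain ⟨p, rfl⟩ := projT_surjective z
  exact ⟨(p, v), rfl⟩

/-- Unit vectors in the cone `|v₂| ≤ D v₁`. -/
lemma cone_of_not_outer {z : T2} {v : ℝ × ℝ} (h₁ : 𝓕 z v = 1) (hv : ¬ D * v.1 < |v.2|) :
    0 < v.1 ∧ |v.2 / v.1| ≤ D := by
  have hD := ha.D_pos
  push Not at hv
  have hne : v ≠ 0 := by
    rintro rfl
    rw [finslerOf_zero] at h₁
    exact zero_ne_one h₁
  have hpos : 0 < v.1 := by
    by_contra! hcon
    have h1 := ha.outer_of_nonpos hne hcon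
    have h2 : v.1 = 0 := le_antisymm hcon (by
      by_contra! hlt
      nlinarith [abs_nonneg v.2, mul_neg_of_pos_of_neg hD hlt])
    rw [h2] at h1 hv
    linarith
  refine ⟨hpos, ?_⟩
  rw [abs_div, abs_of_pos hpos, div_le_iff₀ hpos]
  exact hv

/-- Every unit vector in the cone is the initial velocity of the projection of an integral curve of
the geodesic field. -/
lemma exists_integralCurve_of_cone {p v : ℝ × ℝ} (h₁ : 𝓕 (projT p) v = 1)
    (hv : ¬ D * v.1 < |v.2|) : ∃ γ : ℝ → (ℝ × ℝ) × ℝ,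
      (∀ t, HasDerivAt γ (geodesicField H (γ t)) t) ∧ |(γ 0).2| ≤ D ∧ (γ 0).1 = p ∧
      deriv (fun t => (γ t).1) 0 = v := by
  obtain ⟨hpos, hle⟩ := ha.cone_of_not_outer h₁ hv
  have hD := ha.D_pos
  obtain ⟨γ, h0, hγ⟩ := ha.exists_integralCurve (p, momentum H (p, v.2 / v.1))
  refine ⟨γ, hγ, by rw [h0]; exact ha.ham.abs_momentum_le hle, by rw [h0], ?_⟩
  rw [(hasDerivAt_fst_of_integralCurve hγ 0).deriv, h0, ha.ham.velocity_momentum]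
  rw [ha.finsler_cone p hpos (by linarith)] at h₁
  rw [(eq_inv_of_mul_eq_one_left h₁).symm]
  have := hpos.ne'
  ext <;> simp
  field_simp

lemma exists_geodesic {p v : ℝ × ℝ} (h₁ : 𝓕 (projT p) v = 1) :
    ∃ c, IsGeodesic 𝓕 c ∧ c 0 = p ∧ deriv c 0 = v := by
  by_cases hv : D * v.1 < |v.2|
  · refine ⟨_, ha.isGeodesic_line p hv, by simp, ?_⟩
    have : HasDerivAt (fun s : ℝ => p + s • v) v 0 := by
      simpa using ((hasDerivAt_id (0 : ℝ)).smul_const v).const_add p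
    exact this.deriv
  · obtain ⟨γ, hγ, hle, hp0, hd⟩ := ha.exists_integralCurve_of_cone h₁ hv
    exact ⟨_, ha.isGeodesic_of_integralCurve hγ hle, hp0, hd⟩

/-- Off the cone both curves are straight. A geodesic starting in the cone never leaves it, since
otherwise its velocity would be a constant off the cone; its momentum lift then solves a smooth ODE.
-/
lemma geodesic_unique {c c' : ℝ → ℝ × ℝ} (hc : IsGeodesic 𝓕 c) (hc' : IsGeodesic 𝓕 c')
    (h₁ : 𝓕 (projT (c 0)) (deriv c 0) = 1) (h0 : c 0 = c' 0) (hd : deriv c 0 = deriv c' 0) :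
    c = c' := by
  have h₁' : 𝓕 (projT (c' 0)) (deriv c' 0) = 1 := by rwa [← h0, ← hd]
  by_cases hv : D * (deriv c 0).1 < |(deriv c 0).2|
  · refine integralCurve_unique (X := fun _ => deriv c 0) contDiff_const (fun t => ?_)
      (fun t => ?_) h0
    · rw [← ha.deriv_const_of_outer hc hv t]
      exact hc.hasDerivAt t
    · rw [hd] at hv ⊢
      rw [← ha.deriv_const_of_outer hc' hv t]
      exact hc'.hasDerivAt t
  · have key : ∀ {c : ℝ → ℝ × ℝ}, IsGeodesic 𝓕 c → 𝓕 (projT (c 0)) (deriv c 0) = 1 →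
        ¬ D * (deriv c 0).1 < |(deriv c 0).2| → ∀ t,
        HasDerivAt (fun t => (c t, momentum H (c t, (deriv c t).2 / (deriv c t).1)))
          (geodesicField H (c t, momentum H (c t, (deriv c t).2 / (deriv c t).1))) t := by
      intro c hc h₁ hv
      have hone := ha.finsler_deriv_eq_one hc h₁
      have hcone : ∀ t, 0 < (deriv c t).1 ∧ |(deriv c t).2 / (deriv c t).1| ≤ D := fun t =>
        ha.cone_of_not_outer (hone t) fun hcon => hv (by
          rw [ha.deriv_const_of_outer hc hcon 0]; exact hcon)
      exact ha.integralCurve_of_isGeodesic hc hone (fun t => (hcone t).1) (fun t => (hcone t).2)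
    have := integralCurve_unique (ha.contDiff_geodesicField.of_le (by norm_cast))
      (key hc h₁ hv) (key hc' h₁' (by rwa [← hd])) (by simp only [h0, hd])
    exact funext fun t => congrArg Prod.fst (congrFun this t)

/-- Geodesic trajectories are determined by their starting point. -/
lemma trajectory_unique {c c' : ℝ → ℝ × ℝ} (hc : IsGeodesic 𝓕 c) (hc' : IsGeodesic 𝓕 c')
    (h₁ : 𝓕 (projT (c 0)) (deriv c 0) = 1)
    (h0 : projTT (c 0, deriv c 0) = projTT (c' 0, deriv c' 0)) (t : ℝ) :
    projTT (c t, deriv c t) = projTT (c' t, deriv c' t) := by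
  obtain ⟨hp0, hd0⟩ := Prod.ext_iff.1 h0
  simp only [projTT] at hp0 hd0
  -- The two lifts start at points differing by a lattice vector; translating `c'` by it makes the
  -- initial data equal.
  have hk : projT (c 0 - c' 0) = 0 := by rw [projT_sub, hp0, sub_self]
  have hd : deriv (fun t => c' t + (c 0 - c' 0)) = deriv c' := funext fun t => deriv_add_const _
  have heq := ha.geodesic_unique hc (hc'.add_const (projT_add_of_eq_zero hk)) h₁ (by simp)
    (by rw [hd]; exact hd0)
  have hd' : deriv c = deriv c' := by
    rw [← hd, ← heq]
  rw [hd']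
  simp only [projTT]
  rw [congrFun heq t, projT_add_of_eq_zero hk]

/-- The geodesic flow exists and is complete. -/
lemma exists_geodesicFlow : ∃ φ : ℝ → TT2 → TT2, IsGeodesicFlow 𝓕 φ := by
  have hex : ∀ u : TT2, ∃ c : ℝ → ℝ × ℝ, u ∈ unitTangent 𝓕 →
      IsGeodesic 𝓕 c ∧ projTT (c 0, deriv c 0) = u := by
    intro u
    by_cases hu : u ∈ unitTangent 𝓕
    · obtain ⟨⟨p, v⟩, rfl⟩ := projTT_surjective u
      obtain ⟨c, hc, h0, hd⟩ := ha.exists_geodesic (p := p) (v := v) hu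
      exact ⟨c, fun _ => ⟨hc, by rw [h0, hd]⟩⟩
    · exact ⟨fun _ => 0, fun h => absurd h hu⟩
  choose C hC using hex
  have hone : ∀ u ∈ unitTangent 𝓕, 𝓕 (projT (C u 0)) (deriv (C u) 0) = 1 := fun u hu => by
    have h : projTT (C u 0, deriv (C u) 0) ∈ unitTangent 𝓕 := by rwa [(hC u hu).2]
    exact h
  refine ⟨fun t u => projTT (C u t, deriv (C u) t), fun t u hu =>
    ha.finsler_deriv_eq_one (hC u hu).1 (hone u hu) t, fun u hu γ => ⟨?_, fun h => ?_⟩⟩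
  · rintro ⟨⟨c, hc, hγ⟩, h0⟩ t
    rw [hγ t]
    refine (ha.trajectory_unique (hC u hu).1 hc (hone u hu) ?_ t).symm
    rw [(hC u hu).2, ← hγ 0, h0]
  · exact ⟨⟨C u, (hC u hu).1, h⟩, (h 0).trans (hC u hu).2⟩

end IsAdmissible

/-! ### Smooth maps between quotients -/

section smooth

variable {E₁ E₂ E₃ X Y Z : Type*} [NormedAddCommGroup E₁] [NormedSpace ℝ E₁]
  [NormedAddCommGroup E₂] [NormedSpace ℝ E₂] [NormedAddCommGroup E₃] [NormedSpace ℝ E₃]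
  {pX : E₁ → X} {pY : E₂ → Y} {pZ : E₃ → Z} {f : X → Y} {g : Y → Z}
  {S : Set X} {T : Set Y} {U : Set Z}

lemma IsSmoothOn.comp (hg : IsSmoothOn pY pZ g T) (hf : IsSmoothOn pX pY f S)
    (hST : MapsTo f S T) : IsSmoothOn pX pZ (g ∘ f) S := by
  intro e he
  obtain ⟨G, hG, hGe⟩ := hf e he
  have hmem : pY (G e) ∈ T := by
    rw [← hGe.self_of_nhds he]
    exact hST he
  obtain ⟨K, hK, hKe⟩ := hg (G e) hmem
  refine ⟨K ∘ G, hK.comp e hG, ?_⟩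
  filter_upwards [hGe, hG.continuousAt.tendsto.eventually hKe] with w hw hw' hS
  have h1 := hw hS
  rw [Function.comp_apply, h1, Function.comp_apply]
  exact hw' (by rw [← h1]; exact hST hS)

lemma IsDiffeoOn.comp (hg : IsDiffeoOn pY pZ g T U) (hf : IsDiffeoOn pX pY f S T) :
    IsDiffeoOn pX pZ (g ∘ f) S U := by
  obtain ⟨hgb, hgs, k, hk, hks⟩ := hg
  obtain ⟨hfb, hfs, l, hl, hls⟩ := hf
  have hkm : MapsTo k U T := hk.1.mapsTo hgb.surjOn
  refine ⟨hgb.comp hfb, hgs.comp hfs hfb.mapsTo, l ∘ k, ?_, hls.comp hks hkm⟩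
  exact hl.comp hk hfb.mapsTo hkm

end smooth

/-! ### The section, the Legendre transformation and the time-one maps -/

lemma projZ_surjective : Function.Surjective projZ := by
  rintro ⟨a, v⟩
  obtain ⟨a, rfl⟩ := QuotientAddGroup.mk_surjective a
  exact ⟨(a, v), rfl⟩

/-- The inverse of the Legendre transformation at time `0`. -/
def legendreZeroInv (H : T2 → ℝ → ℝ) (z : Cyl) : Cyl :=
  (z.1, Function.invFun (deriv (H (0, z.1))) z.2)

namespace IsConvexHamiltonian

variable {H : T2 → ℝ → ℝ} {D Dp Dm : ℝ} (hH : IsConvexHamiltonian H D Dp Dm)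
include hH

lemma legendreZero_projZ (x y : ℝ) :
    legendreZero H (projZ (x, y)) = projZ (x, velocity H ((0, x), y)) := by
  rw [← deriv_fibre hH.contDiff_lift]
  rfl

lemma legendreZeroInv_projZ (x v : ℝ) :
    legendreZeroInv H (projZ (x, v)) = projZ (x, momentum H ((0, x), v)) := by
  rw [momentum, ← deriv_fibre_fun hH.contDiff_lift]
  rfl

lemma legendreZero_legendreZeroInv (z : Cyl) : legendreZero H (legendreZeroInv H z) = z := by
  obtain ⟨⟨x, v⟩, rfl⟩ := projZ_surjective z
  rw [hH.legendreZeroInv_projZ, hH.legendreZero_projZ, hH.velocity_momentum]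

lemma legendreZeroInv_legendreZero (z : Cyl) : legendreZeroInv H (legendreZero H z) = z := by
  obtain ⟨⟨x, v⟩, rfl⟩ := projZ_surjective z
  rw [hH.legendreZero_projZ, hH.legendreZeroInv_projZ, hH.momentum_velocity]

lemma isDiffeoOn_legendreZeroInv : IsDiffeoOn projZ projZ (legendreZeroInv H) univ univ := by
  have hinv : InvOn (legendreZero H) (legendreZeroInv H) univ univ :=
    ⟨fun z _ => hH.legendreZero_legendreZeroInv z, fun z _ => hH.legendreZeroInv_legendreZero z⟩
  refine ⟨hinv.bijOn (mapsTo_univ _ _) (mapsTo_univ _ _), ?_, legendreZero H, hinv, ?_⟩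
  · refine fun e _ => ⟨fun q => (q.1, momentum H ((0, q.1), q.2)), ?_, Eventually.of_forall
      fun q _ => hH.legendreZeroInv_projZ q.1 q.2⟩
    have := hH.contDiff_momentum
    exact (contDiff_fst.prodMk (this.comp
      ((contDiff_const.prodMk contDiff_fst).prodMk contDiff_snd))).contDiffAt
  · refine fun e _ => ⟨fun q => (q.1, velocity H ((0, q.1), q.2)), ?_, Eventually.of_forall
      fun q _ => hH.legendreZero_projZ q.1 q.2⟩
    have := contDiff_velocity hH.contDiff_lift
    exact (contDiff_fst.prodMk (this.comp
      ((contDiff_const.prodMk contDiff_fst).prodMk contDiff_snd))).contDiffAt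

/-- By periodicity in time the Legendre transformations at times `0` and `1` agree, so a single map
converts both ends of a time-one trajectory. -/
lemma projZ_velocity_one (x y : ℝ) :
    projZ (x, velocity H ((1, x), y)) = legendreZero H (projZ (x, y)) := by
  have hk : projT ((1 : ℤ), (0 : ℤ)) = 0 := projT_int 1 0
  have h := velocity_add (H := H) hk ((0, x), y)
  rw [hH.legendreZero_projZ, ← h]
  simp

end IsConvexHamiltonian

namespace IsAdmissible

variable {H : T2 → ℝ → ℝ} {D Dp Dm A B : ℝ} {hp hm : ℝ → ℝ}
  (ha : IsAdmissible H D Dp Dm A B hp hm)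
include ha

local notation "𝓕" => finslerOf A B (modifiedLagrangian H D hp hm)

/-- The slope map is a diffeomorphism from the section onto the cylinder. -/
lemma isDiffeoOn_slopeMap : IsDiffeoOn projTT projZ slopeMap (V0 𝓕) univ := by
  set L := modifiedLagrangian H D hp hm with hL
  -- On unit vectors `v₁ L(0, h, m) = 1` with slope `m = v₂ / v₁`, so the slope determines `v₁ = 1 /
  -- L` and `v₂ = m v₁`.
  set k : Cyl → TT2 := fun z =>
    ((0, z.1), ((L (0, z.1) z.2)⁻¹, z.2 * (L (0, z.1) z.2)⁻¹)) with hk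
  have hLpos : ∀ z v, 0 < L z v := ha.modified_pos
  have hkm : MapsTo k univ (V0 𝓕) := by
    intro z _
    have hpos := hLpos (0, z.1) z.2
    refine ⟨?_, rfl, inv_pos.2 hpos⟩
    change finslerOf A B L (0, z.1) _ = 1
    rw [finslerOf_of_pos _ (inv_pos.2 hpos), mul_div_cancel_right₀ _ (inv_pos.2 hpos).ne',
      inv_mul_cancel₀ hpos.ne']
  have hinv : InvOn k slopeMap (V0 𝓕) univ := by
    constructor
    · rintro ⟨⟨t, x⟩, v⟩ ⟨h1, h2, h3⟩
      change finslerOf A B L (t, x) v = 1 at h1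
      change t = 0 at h2
      change 0 < v.1 at h3
      subst h2
      rw [finslerOf_of_pos _ h3] at h1
      have h4 : (L (0, x) (v.2 / v.1))⁻¹ = v.1 := (eq_inv_of_mul_eq_one_left h1).symm
      simp only [hk, slopeMap]
      rw [h4, div_mul_cancel₀ _ h3.ne']
    · intro z _
      have hpos := hLpos (0, z.1) z.2
      simp only [hk, slopeMap]
      rw [mul_div_cancel_right₀ _ (inv_pos.2 hpos).ne']
  refine ⟨hinv.bijOn (mapsTo_univ _ _) hkm, ?_, k, hinv, ?_⟩
  · intro e he
    have h3 : 0 < e.2.1 := he.2.2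
    refine ⟨fun w => (w.1.2, w.2.2 / w.2.1), ?_, Eventually.of_forall fun w _ => rfl⟩
    exact ContDiffAt.prodMk (by fun_prop) (ContDiffAt.div (by fun_prop) (by fun_prop) h3.ne')
  · intro e _
    have hLs : ContDiff ℝ ∞ (fun q : ℝ × ℝ => (lift L ((0, q.1), q.2))⁻¹) :=
      (ha.contDiff_modified.comp
        ((contDiff_const.prodMk contDiff_fst).prodMk contDiff_snd)).inv fun q => (hLpos _ _).ne'
    refine ⟨fun q => ((0, q.1), ((lift L ((0, q.1), q.2))⁻¹, q.2 * (lift L ((0, q.1), q.2))⁻¹)),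
      ?_, Eventually.of_forall fun q _ => rfl⟩
    exact ((contDiff_const.prodMk contDiff_fst).prodMk
      (hLs.prodMk (contDiff_snd.mul hLs))).contDiffAt

/-- The time-one map of the Euler–Lagrange flow is conjugate to that of the Hamiltonian flow. -/
lemma isLagrangeTimeOneMap {f : Cyl → Cyl} (hf : IsHamiltonTimeOneMap H f) :
    IsLagrangeTimeOneMap (modifiedLagrangian H D hp hm)
      (fun z => legendreZero H (f (legendreZeroInv H z))) := by
  have hder : ∀ {x y : ℝ → ℝ}, IsHamiltonSolution H x y →
      projZ (x 0, deriv x 0) = legendreZero H (projZ (x 0, y 0)) ∧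
      projZ (x 1, deriv x 1) = legendreZero H (projZ (x 1, y 1)) := by
    intro x y h
    have hs := ha.ham.isHamiltonSolution_iff.1 h
    rw [(hs 0).1.deriv, (hs 1).1.deriv, ha.ham.projZ_velocity_one, ha.ham.legendreZero_projZ]
    exact ⟨rfl, rfl⟩
  intro z w
  simp only []
  constructor
  · intro h
    obtain ⟨x, y, hxy, h0, h1⟩ := (hf (legendreZeroInv H z) _).1 rfl
    refine ⟨x, ha.isEulerLagrange_iff.2 ⟨y, hxy⟩, ?_, ?_⟩
    · rw [(hder hxy).1, h0, ha.ham.legendreZero_legendreZeroInv]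
    · rw [(hder hxy).2, h1, h]
  · rintro ⟨θ, hθ, h0, h1⟩
    obtain ⟨y, hy⟩ := ha.isEulerLagrange_iff.1 hθ
    rw [(hder hy).1] at h0
    rw [(hder hy).2] at h1
    rw [← h0, ha.ham.legendreZeroInv_legendreZero, ← h1]
    exact congrArg _ ((hf _ _).2 ⟨θ, y, hy, rfl, rfl⟩)

end IsAdmissible

/-- A function with derivative bounded below by a positive constant is an increasing bijection, and
its inverse is differentiable. -/
lemma exists_inverse_of_deriv_ge {τ τ' : ℝ → ℝ} (hτ : ∀ s, HasDerivAt τ (τ' s) s) {δ : ℝ}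
    (hδ : 0 < δ) (hge : ∀ s, δ ≤ τ' s) : StrictMono τ ∧ ∃ σ : ℝ → ℝ, (∀ s, σ (τ s) = s) ∧
      (∀ t, τ (σ t) = t) ∧ ∀ t, HasDerivAt σ (τ' (σ t))⁻¹ t := by
  have hmono : StrictMono τ := strictMono_of_deriv_pos fun s => by
    rw [(hτ s).deriv]
    exact hδ.trans_le (hge s)
  have hcont : Continuous τ := continuous_iff_continuousAt.2 fun s => (hτ s).continuousAt
  -- This linear comparison forces `τ` to tend to `±∞`, hence surjectivity.
  have hsub : Monotone fun s => τ s - δ * s :=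
    monotone_of_deriv_nonneg (fun s => ((hτ s).sub ((hasDerivAt_id s).const_mul δ)).differentiableAt)
      fun s => by
        have h : HasDerivAt (fun s => τ s - δ * s) (τ' s - δ * 1) s :=
          (hτ s).sub ((hasDerivAt_id s).const_mul δ)
        rw [h.deriv]
        linarith [hge s]
  have htop : Tendsto τ atTop atTop := by
    refine tendsto_atTop_mono' atTop ?_
      (tendsto_atTop_add_const_left _ (τ 0) (tendsto_id.const_mul_atTop hδ))
    filter_upwards [eventually_ge_atTop 0] with s hs
    have := hsub hs
    simp only [mul_zero, sub_zero] at this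
    simp only [id]
    linarith
  have hbot : Tendsto τ atBot atBot := by
    refine tendsto_atBot_mono' atBot ?_
      (tendsto_atBot_add_const_left _ (τ 0) (tendsto_id.const_mul_atBot hδ))
    filter_upwards [eventually_le_atBot 0] with s hs
    have := hsub hs
    simp only [mul_zero, sub_zero] at this
    simp only [id]
    linarith
  set e := hmono.orderIsoOfSurjective τ (hcont.surjective htop hbot) with he
  refine ⟨hmono, e.symm, fun s => e.symm_apply_apply s, fun t => e.apply_symm_apply t,
    fun t => ?_⟩
  exact HasDerivAt.of_local_left_inverse e.symm.continuous.continuousAt (hτ _)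
    (hδ.trans_le (hge _)).ne' (Eventually.of_forall fun t => e.apply_symm_apply t)

/-! ### Time change and first return -/

namespace IsAdmissible

variable {H : T2 → ℝ → ℝ} {D Dp Dm A B : ℝ} {hp hm : ℝ → ℝ}
  (ha : IsAdmissible H D Dp Dm A B hp hm)
include ha

local notation "𝓕" => finslerOf A B (modifiedLagrangian H D hp hm)

/-- On `|v| ≤ D` the Lagrangian is bounded. -/
lemma exists_lagrangian_le : ∃ M > 0, ∀ p : ℝ × ℝ, ∀ v : ℝ, |v| ≤ D → lagrangian H (p, v) ≤ M := by
  have hD := ha.D_pos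
  have hDp := ha.Dp_neg
  have hDm := ha.Dm_neg
  -- The tangent line at `v` is evaluated at whichever of `±(D + 1/2)` the momentum points to, so
  -- `L(v)` is at most `L` there. Both points lie where `L = v² / 2 - D±`; as `D₊` and `D₋` are
  -- negative, subtracting both covers the two cases.
  refine ⟨(D + 1 / 2) ^ 2 / 2 - Dp - Dm, by nlinarith, fun p v hv => ?_⟩
  obtain ⟨hv1, hv2⟩ := abs_le.1 hv
  have ht := tangent_le_of_deriv2_pos
    ((ha.contDiff_modified_fibre (projT p)).of_le (by norm_cast))
    (ha.deriv2_modified_pos (projT p)) v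
  rw [ha.deriv_modified_of_abs_lt p (by linarith), ha.modified_of_abs_lt p (by linarith)] at ht
  rcases le_total 0 (momentum H (p, v)) with h | h
  · have h1 := ht (D + 1 / 2)
    rw [ha.modified_of_lt _ (by linarith), ha.hp_inner _ (by linarith)] at h1
    nlinarith [mul_nonneg h (by linarith : 0 ≤ D + 1 / 2 - v)]
  · have h1 := ht (-(D + 1 / 2))
    rw [modifiedLagrangian_of_lt_neg _ (by linarith), ha.hm_inner _ (by linarith)] at h1
    nlinarith [mul_nonneg_of_nonpos_of_nonpos h (by linarith : -(D + 1 / 2) - v ≤ 0)]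

/-- Unit speed geodesics transverse to the section are reparametrised graphs of solutions of
Hamilton's equations. -/
lemma exists_hamiltonSolution {c : ℝ → ℝ × ℝ} (hc : IsGeodesic 𝓕 c)
    (h₁ : 𝓕 (projT (c 0)) (deriv c 0) = 1) (hpos : 0 < (deriv c 0).1) :
    (∀ s, 0 < (deriv c s).1) ∧ StrictMono (fun s => (c s).1) ∧
      Function.Surjective (fun s => (c s).1) ∧
      ∃ x y : ℝ → ℝ, IsHamiltonSolution H x y ∧ ∀ s, (c s).2 = x (c s).1 ∧
        (deriv c s).2 / (deriv c s).1 = velocity H (c s, y (c s).1) := by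
  have hd1 : ∀ s, HasDerivAt (fun s => (c s).1) (deriv c s).1 s := fun s =>
    (ContinuousLinearMap.fst ℝ ℝ ℝ).hasFDerivAt.comp_hasDerivAt s (hc.hasDerivAt s)
  have hd2 : ∀ s, HasDerivAt (fun s => (c s).2) (deriv c s).2 s := fun s =>
    (ContinuousLinearMap.snd ℝ ℝ ℝ).hasFDerivAt.comp_hasDerivAt s (hc.hasDerivAt s)
  -- It suffices to find a lower bound for the speed of the first coordinate and a momentum `Y`
  -- obeying Hamilton's equation multiplied by that speed. Inverting the first coordinate removes
  -- the factor.
  suffices hY : ∃ δ > 0, (∀ s, δ ≤ (deriv c s).1) ∧ ∃ Y : ℝ → ℝ,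
      (∀ s, (deriv c s).2 / (deriv c s).1 = velocity H (c s, Y s)) ∧
      ∀ s, HasDerivAt Y ((deriv c s).1 * -fderiv ℝ (lift H) (c s, Y s) ((0, 1), 0)) s by
    obtain ⟨δ, hδ, hge, Y, hvel, hYd⟩ := hY
    have hpos' : ∀ s, 0 < (deriv c s).1 := fun s => hδ.trans_le (hge s)
    obtain ⟨hmono, σ, hσ1, hσ2, hσd⟩ := exists_inverse_of_deriv_ge hd1 hδ hge
    refine ⟨hpos', hmono, fun t => ⟨σ t, hσ2 t⟩, fun t => (c (σ t)).2, fun t => Y (σ t),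
      ha.ham.isHamiltonSolution_iff.2 fun t => ?_, fun s => ?_⟩
    · have hct : (t, (c (σ t)).2) = c (σ t) := Prod.ext (hσ2 t).symm rfl
      rw [hct]
      have hne := (hpos' (σ t)).ne'
      refine ⟨((hd2 (σ t)).comp t (hσd t)).congr_deriv ?_,
        ((hYd (σ t)).comp t (hσd t)).congr_deriv ?_⟩
      · rw [← hvel, div_eq_mul_inv]
      · field_simp
    · simp only [hσ1]
      exact ⟨trivial, hvel s⟩
  by_cases hv : D * (deriv c 0).1 < |(deriv c 0).2|
  · have hconst := ha.deriv_const_of_outer hc hv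
    have hslope : D < |(deriv c 0).2 / (deriv c 0).1| := by
      rwa [abs_div, abs_of_pos hpos, lt_div_iff₀ hpos]
    refine ⟨(deriv c 0).1, hpos, fun s => by rw [hconst s],
      fun _ => (deriv c 0).2 / (deriv c 0).1, fun s => ?_, fun s => ?_⟩
    · rw [hconst s, ha.ham.velocity_of_lt_abs _ hslope]
    · rw [ha.ham.fderiv_lift_base_eq_zero _ _ hslope, neg_zero, mul_zero]
      exact hasDerivAt_const _ _
  · have hone := ha.finsler_deriv_eq_one hc h₁
    have hcone : ∀ t, 0 < (deriv c t).1 ∧ |(deriv c t).2 / (deriv c t).1| ≤ D := fun t =>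
      ha.cone_of_not_outer (hone t) fun hcon => hv (by
        rw [ha.deriv_const_of_outer hc hcon 0]; exact hcon)
    have hγ := ha.integralCurve_of_isGeodesic hc hone (fun t => (hcone t).1) (fun t => (hcone t).2)
    have hnorm : ∀ s, (deriv c s).1 * lagrangian H (c s, (deriv c s).2 / (deriv c s).1) = 1 :=
      fun s => by
        rw [← ha.finsler_cone _ (hcone s).1 (by linarith [(hcone s).2]), hone]
    obtain ⟨M, hM, hle⟩ := ha.exists_lagrangian_le
    refine ⟨M⁻¹, inv_pos.2 hM, fun s => ?_,
      fun s => momentum H (c s, (deriv c s).2 / (deriv c s).1),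
      fun s => (ha.ham.velocity_momentum _ _).symm, fun s => ?_⟩
    -- In the cone the first coordinate moves at speed `1 / L ≥ 1 / M`.
    · rw [eq_inv_of_mul_eq_one_left (hnorm s)]
      exact inv_anti₀ (ha.lagrangian_pos _) (hle _ _ (hcone s).2)
    · refine (hasDerivAt_snd_of_integralCurve hγ s).congr_deriv ?_
      simp only []
      rw [ha.ham.velocity_momentum, ← eq_inv_of_mul_eq_one_left (hnorm s)]

/-- Every point of the section returns to it, and the return is described by a solution of
Hamilton's equations. -/
lemma exists_return {φ : ℝ → TT2 → TT2} (hφ : IsGeodesicFlow 𝓕 φ) {u : TT2} (hu : u ∈ V0 𝓕) :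
    ∃ τ : ℝ, 0 < τ ∧ φ τ u ∈ V0 𝓕 ∧ (∀ t ∈ Ioo 0 τ, φ t u ∉ V0 𝓕) ∧
      ∃ x y : ℝ → ℝ, IsHamiltonSolution H x y ∧
        slopeMap u = legendreZero H (projZ (x 0, y 0)) ∧
        slopeMap (φ τ u) = legendreZero H (projZ (x 1, y 1)) := by
  obtain ⟨h1, h2, h3⟩ := hu
  obtain ⟨⟨t₀, z⟩, v⟩ := u
  change t₀ = 0 at h2
  subst h2
  obtain ⟨x₀, rfl⟩ := QuotientAddGroup.mk_surjective z
  obtain ⟨c, hc, hc0, hd0⟩ := ha.exists_geodesic (p := (0, x₀)) (v := v) h1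
  have hone0 : 𝓕 (projT (c 0)) (deriv c 0) = 1 := by rw [hc0, hd0]; exact h1
  obtain ⟨hpos, hmono, hsurj, x, y, hxy, hgraph⟩ :=
    ha.exists_hamiltonSolution hc hone0 (by rw [hd0]; exact h3)
  have hflow : ∀ t, projTT (c t, deriv c t) = φ t _ :=
    (hφ.2 _ h1 fun t => projTT (c t, deriv c t)).1
      ⟨⟨c, hc, fun _ => rfl⟩, by simp only [hc0, hd0]; rfl⟩
  -- The return time: the lifted first coordinate increases from `0` and meets the section exactly
  -- at integers.
  obtain ⟨τ, hτ⟩ := hsurj 1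
  have hτ1 : (c τ).1 = 1 := hτ
  have hc01 : (c 0).1 = 0 := by rw [hc0]
  have hτpos : 0 < τ := hmono.lt_iff_lt.1 (by simp only [hc01, hτ1]; exact one_pos)
  refine ⟨τ, hτpos, ⟨hφ.1 τ h1, ?_, ?_⟩, fun t ht hmem => ?_, x, y, hxy, ?_, ?_⟩
  · rw [← hflow]
    change (((c τ).1 : ℝ) : S1) = 0
    rw [hτ1]
    exact_mod_cast coe_int_eq_zero 1
  · rw [← hflow]
    exact hpos τ
  · have h4 := hmem.2.1
    rw [← hflow] at h4
    change (((c t).1 : ℝ) : S1) = 0 at h4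
    obtain ⟨n, hn⟩ := (AddCircle.coe_eq_zero_iff (1 : ℝ)).1 h4
    have hlt0 : (c 0).1 < (c t).1 := hmono ht.1
    have hlt1 : (c t).1 < (c τ).1 := hmono ht.2
    rw [← hn, zsmul_eq_mul, mul_one] at hlt0 hlt1
    rw [hc01] at hlt0
    rw [hτ1] at hlt1
    have h5 : 0 < n := by exact_mod_cast hlt0
    have h6 : n < 1 := by exact_mod_cast hlt1
    omega
  · obtain ⟨g1, g2⟩ := hgraph 0
    rw [hc01] at g1 g2
    rw [hd0, hc0] at g2
    rw [ha.ham.legendreZero_projZ, ← g1, hc0]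
    simp only [slopeMap, g2]
    rfl
  · obtain ⟨g1, g2⟩ := hgraph τ
    rw [hτ1] at g1 g2
    have hcτ : c τ = (1, x 1) := Prod.ext hτ1 g1
    rw [← hflow, ← ha.ham.projZ_velocity_one]
    rw [hcτ] at g2
    simp only [slopeMap, projTT, g2, hcτ]
    rfl

end IsAdmissible

end FinslerTwist

end

open FinslerTwist in
theorem mainTheorem2
    (H : T2 → ℝ → ℝ) (D Dp Dm : ℝ) (hD : 0 < D) (hH : IsConvexHamiltonian H D Dp Dm)
    (f : Cyl → Cyl) (hf : IsHamiltonTimeOneMap H f)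
    (A B : ℝ) (hA : 0 < A) (hB : 0 < B) (hp hm : ℝ → ℝ)
    (hp_smooth : ContDiff ℝ ∞ hp) (hm_smooth : ContDiff ℝ ∞ hm)
    (hp_convex : ∀ y, 0 < deriv (deriv hp) y) (hm_convex : ∀ y, 0 < deriv (deriv hm) y)
    (hp_inner : ∀ y, y < D + 1 → hp y = y ^ 2 / 2 - Dp)
    (hp_outer : ∀ y, D + 2 < y → hp y = Real.sqrt (A + B * y ^ 2))
    (hm_inner : ∀ y, -D - 1 < y → hm y = y ^ 2 / 2 - Dm)
    (hm_outer : ∀ y, y < -D - 2 → hm y = Real.sqrt (A + B * y ^ 2))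
    (L : T2 → ℝ → ℝ) (hL : L = modifiedLagrangian H D hp hm)
    (F : T2 → ℝ × ℝ → ℝ) (hF : F = finslerOf A B L) :
    IsFinsler F ∧
    ∃ (φ : ℝ → TT2 → TT2) (R : TT2 → TT2),
      IsGeodesicFlow F φ ∧ IsFirstReturnMap φ (V0 F) R ∧
      -- the explicit map `g` conjugates `R` to the time-one map of the Euler–Lagrange flow of `L`
      IsDiffeoOn projTT projZ slopeMap (V0 F) Set.univ ∧
      (∃ E : Cyl → Cyl, IsLagrangeTimeOneMap L E ∧
        ∀ u ∈ V0 F, slopeMap (R u) = E (slopeMap u)) ∧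
      -- read in position-momentum coordinates, it conjugates `R` to `f`
      ∃ Φ : TT2 → Cyl, IsDiffeoOn projTT projZ Φ (V0 F) Set.univ ∧
        (∀ u ∈ V0 F, legendreZero H (Φ u) = slopeMap u) ∧
        ∀ u ∈ V0 F, Φ (R u) = f (Φ u) := by
  subst hL hF
  have ha : IsAdmissible H D Dp Dm A B hp hm :=
    ⟨hD, hH, hA, hB, hp_smooth, hm_smooth, hp_convex, hm_convex, hp_inner, hp_outer, hm_inner,
      hm_outer⟩
  obtain ⟨φ, hφ⟩ := ha.exists_geodesicFlow
  -- The return map is the flow at the chosen return time, and `Φ` is the slope followed by the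
  -- inverse Legendre transformation. Both conjugacies follow by evaluating `f` on the Hamiltonian
  -- solution attached to each point.
  have hret := fun u (hu : u ∈ V0 (finslerOf A B (modifiedLagrangian H D hp hm))) =>
    ha.exists_return hφ hu
  choose! τ hτpos hτmem hτfirst x y hxy h0 h1 using hret
  refine ⟨ha.isFinsler, φ, fun u => φ (τ u) u, hφ,
    fun u hu => ⟨τ u, hτpos u hu, rfl, hτmem u hu, hτfirst u hu⟩, ha.isDiffeoOn_slopeMap,
    ⟨_, ha.isLagrangeTimeOneMap hf, fun u hu => ?_⟩, legendreZeroInv H ∘ slopeMap,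
    hH.isDiffeoOn_legendreZeroInv.comp ha.isDiffeoOn_slopeMap,
    fun u _ => hH.legendreZero_legendreZeroInv _, fun u hu => ?_⟩
  · rw [h0 u hu, h1 u hu, hH.legendreZeroInv_legendreZero]
    exact congrArg _ ((hf _ _).2 ⟨x u, y u, hxy u hu, rfl, rfl⟩).symm
  · simp only [Function.comp_apply]
    rw [h0 u hu, h1 u hu, hH.legendreZeroInv_legendreZero, hH.legendreZeroInv_legendreZero]
    exact ((hf _ _).2 ⟨x u, y u, hxy u hu, rfl, rfl⟩).symm
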